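/- **Proposition (Core-space flow-matching and generation guarantee).** Let $d\in\mathbb N$, let $q=\mathcal N(0,I_d)$, and let $p_s^*$ be a probability distribution on $\mathbb R^d$. Let $v,\hat v:\mathbb R^d\times[0,1]\to\mathbb R^d$ be measurable velocity fields (target and learned) whose ODEs $\dot x=v(x,t)$ and $\dot x=\hat v(x,t)$ have, for every initial point $x(0)=x\in\mathbb R^d$, an absolutely continuous solution on $[0,1]$; denote the flows by $\Phi_t,\hat\Phi_t$. Let $\rho_t$ and $\hat\rho_t$ be the Lebesgue densities of $(\Phi_t)_\#p_s^*$ and $(\hat\Phi_t)_\#p_s^*$, $t\in[0,1]$, and suppose that $v$ transports $p_s^*$ to $q$, i.e. $(\Phi_1)_\#p_s^*=q$. Assume that there are constants $\varepsilon,C_1,C_2,L,L_v>0$ such that, for all $t\in[0,1]$ and $x,y\in\mathbb R^d$: 1. $\int_0^1\int_{\mathbb R^d}\|v(x,t)-\hat v(x,t)\|^2\rho_t(x)\,dx\,dt\le\varepsilon^2$; 2. $\|v(x,t)-v(y,t)\|\le L_v\|x-y\|$ and $\|\hat v(x,t)-\hat v(y,t)\|\le L_v\|x-y\|$; 3. $0<\rho_t(x)\le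 C_1e^{-\|x\|^2/2}$ and $0<\hat\rho_t(x)\le C_1e^{-\|x\|^2/2}$; 4. $\rho_t$ and $\hat\rho_t$ are differentiable in $x$, with $\|\nabla\log\rho_t(x)\|\le L(1+\|x\|)$ and $\|\nabla\log\hat\rho_t(x)\|\le L(1+\|x\|)$; 5. $\int_{\mathbb R^d}(1+\|x\|)^2\,\dfrac{\rho_t(x)^3}{\hat\rho_t(x)^2}\,dx\le C_2$. Then the learned flow map $\hat T:=\hat\Phi_1$ is a homeomorphism of $\mathbb R^d$, and there is a constant $C_F>0$ depending only on $(C_1,C_2,L,d)$ such that, for the terminal distribution $\hat\rho_1=\hat T_\#p_s^*$ and the generated core distribution $\hat p_s:=(\hat T^{-1})_\#q$, $$\chi^2(\hat\rho_1\,\|\,q)\le C_F\,\varepsilon,\qquad \chi^2(p_s^*\,\|\,\hat p_s)\le C_F\,\varepsilon,$$ where $\chi^2(\mu\|\nu)=\int\bigl(\tfrac{d\mu}{d\nu}-1\bigr)^2d\nu$ if $\mu\ll\nu$, and $+\infty$ otherwise. -/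

import Mathlib

open MeasureTheory ProbabilityTheory Set

noncomputable section

/-- The chi-square divergence `χ²(μ ‖ ν) = ∫ (dμ/dν - 1)² dν`, with value `∞` when `μ` is not
absolutely continuous with respect to `ν`. -/
def chiSqDiv {α : Type*} [MeasurableSpace α] (μ ν : Measure α) : ENNReal :=
  open Classical in
  if μ ≪ ν then ∫⁻ x, ENNReal.ofReal (((μ.rnDeriv ν x).toReal - 1) ^ 2) ∂ν else ⊤

/-- `Φ x t` is the position at time `t ∈ [0,1]` of the solution of `ẋ = v(x,t)` that starts at `x`
at time `0`. The ODE is understood in integrated form, which agrees with the classical form when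
`v` is continuous and makes sense when `v` is only measurable in time. -/
def IsFlow {d : ℕ} (v : EuclideanSpace ℝ (Fin d) → ℝ → EuclideanSpace ℝ (Fin d))
    (Φ : EuclideanSpace ℝ (Fin d) → ℝ → EuclideanSpace ℝ (Fin d)) : Prop :=
  ∀ x, IntervalIntegrable (fun τ => v (Φ x τ) τ) volume 0 1 ∧
    ∀ t ∈ Icc (0 : ℝ) 1, Φ x t = x + ∫ τ in (0 : ℝ)..t, v (Φ x τ) τ

/-- For every `t ∈ [0,1]`, the function `ρ t` is a density (with respect to Lebesgue measure) of
the law at time `t` of the trajectories of the flow `Φ` started from `p` at time `0`. -/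
def IsDensityPath {d : ℕ} (p : Measure (EuclideanSpace ℝ (Fin d)))
    (Φ : EuclideanSpace ℝ (Fin d) → ℝ → EuclideanSpace ℝ (Fin d))
    (ρ : ℝ → EuclideanSpace ℝ (Fin d) → ℝ) : Prop :=
  ∀ t ∈ Icc (0 : ℝ) 1,
    p.map (fun x => Φ x t) = volume.withDensity (fun x => ENNReal.ofReal (ρ t x))

/-- The regularity conditions on the target field `v` with density path `ρ` and the learned
field `v'` with density path `ρ'`. Integrals of nonnegative functions are taken with values in
`[0,∞]`, so a finite bound includes integrability. -/
structure FlowMatchingRegularity {d : ℕ} (ε C₁ C₂ L Lv : ℝ)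
    (v v' : EuclideanSpace ℝ (Fin d) → ℝ → EuclideanSpace ℝ (Fin d))
    (ρ ρ' : ℝ → EuclideanSpace ℝ (Fin d) → ℝ) : Prop where
  /-- flow-matching error -/
  error : ∫⁻ t in Icc (0 : ℝ) 1, ∫⁻ x, ENNReal.ofReal (‖v x t - v' x t‖ ^ 2 * ρ t x)
    ≤ ENNReal.ofReal (ε ^ 2)
  /-- velocity regularity -/
  lipschitz : ∀ t ∈ Icc (0 : ℝ) 1, ∀ x y, ‖v x t - v y t‖ ≤ Lv * ‖x - y‖
  lipschitz' : ∀ t ∈ Icc (0 : ℝ) 1, ∀ x y, ‖v' x t - v' y t‖ ≤ Lv * ‖x - y‖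
  /-- density bounds -/
  bound : ∀ t ∈ Icc (0 : ℝ) 1, ∀ x, 0 < ρ t x ∧ ρ t x ≤ C₁ * Real.exp (-‖x‖ ^ 2 / 2)
  bound' : ∀ t ∈ Icc (0 : ℝ) 1, ∀ x, 0 < ρ' t x ∧ ρ' t x ≤ C₁ * Real.exp (-‖x‖ ^ 2 / 2)
  /-- score regularity: the scores exist and grow at most linearly -/
  differentiable : ∀ t ∈ Icc (0 : ℝ) 1, Differentiable ℝ (ρ t)
  differentiable' : ∀ t ∈ Icc (0 : ℝ) 1, Differentiable ℝ (ρ' t)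
  score : ∀ t ∈ Icc (0 : ℝ) 1, ∀ x,
    ‖gradient (fun y => Real.log (ρ t y)) x‖ ≤ L * (1 + ‖x‖)
  score' : ∀ t ∈ Icc (0 : ℝ) 1, ∀ x,
    ‖gradient (fun y => Real.log (ρ' t y)) x‖ ≤ L * (1 + ‖x‖)
  /-- density ratio integrability -/
  ratio : ∀ t ∈ Icc (0 : ℝ) 1,
    ∫⁻ x, ENNReal.ofReal ((1 + ‖x‖) ^ 2 * (ρ t x ^ 3 / ρ' t x ^ 2)) ≤ ENNReal.ofReal C₂

end

open Filter Topology
open scoped NNReal ENNReal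

/-! ### Chi-square divergence -/

/-! Write `P = ρ t`, `Q = ρ' t`, `r = P / Q` and `F t = ∫ P² / Q`, so that `F t - 1` is the
divergence `χ²(P ‖ Q)`. Formally, the two continuity equations give `F' = ∫ ∇(2r)·v P - ∇(r²)·v' Q`,
and `r Q = P` collapses this to `2 ∫ ∇r·(v - v') P`. The score bounds give `|∇r| ≤ 2L(1 + |x|) r`.
Since `r² P = P³ / Q²`, Cauchy–Schwarz in space-time bounds the total growth by `4 L √C₂ ε`. Both
flows start from the same law, so `F 0 = 1` and `F 1 ≤ 1 + 4 L √C₂ ε` (`lintegral_sq_div_le`).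

This controls `χ²(q ‖ ρ' 1)`, the reverse of the divergence wanted. The Gaussian upper bound on `ρ'
1` says `ρ' 1 ≤ C₁ (2π)^(d/2) q`, and this factor is the price of exchanging the arguments
(`chiSqDiv_withDensity_le`). The bound for the generated distribution is then the same bound,
because the divergence is invariant under the invertible map `T⁻¹`.

The formal computation is not licensed: `r` may be unbounded and the densities are not known to be
differentiable in time. The ratio is therefore damped to `g = P / (Q + δ P) ≤ 1 / δ`, and time
derivatives are avoided by the variational formula `P² / (Q + δ P) = max_s ((2s - δ s²) P - s² Q)`,
attained at `s = g`. Freezing `s` at the later end of a time step bounds the growth over the step by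
increments of integrals of fixed test functions (`integral_dampedRatio_sub_le`), to which the weak
continuity equation applies (`integral_mul_density_sub`). Freezing leaves an error containing `(1 -
δ g) P - g Q` with `g` and the densities at different times; it vanishes when the times agree, so it
disappears as the partition is refined, by continuity of the densities in time. Fatou's lemma
removes `δ`.

The terminal map is bi-Lipschitz by Grönwall forwards and backwards in time. Backward solvability is
not needed for surjectivity: the closed range carries a law with positive density, so its open
complement is null and hence empty. -/

theorem chiSqDiv_map_measurableEquiv {α β : Type*} [MeasurableSpace α] [MeasurableSpace β]
    (e : α ≃ᵐ β) (μ ν : Measure α) [SigmaFinite μ] [SigmaFinite ν] :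
    chiSqDiv (μ.map e) (ν.map e) = chiSqDiv μ ν := by
  have hac : μ.map e ≪ ν.map e ↔ μ ≪ ν := by
    refine ⟨fun h => ?_, fun h => h.map e.measurable⟩
    have := h.map e.symm.measurable
    simpa [Measure.map_map e.symm.measurable e.measurable] using this
  unfold chiSqDiv
  by_cases h : μ ≪ ν
  · rw [if_pos h, if_pos (hac.2 h), e.measurableEmbedding.lintegral_map]
    refine lintegral_congr_ae ?_
    filter_upwards [e.measurableEmbedding.rnDeriv_map μ ν] with x hx
    rw [hx]
  · rw [if_neg h, if_neg (mt hac.1 h)]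

/-- The chi-square divergence of two measures with positive densities `P` and `Q` is controlled by
the reverse divergence when `Q ≤ K * P`. -/
theorem chiSqDiv_withDensity_le {α : Type*} [MeasurableSpace α] {m : Measure α} [SigmaFinite m]
    {P Q : α → ℝ} (hP : Measurable P) (hQ : Measurable Q) (hP0 : ∀ x, 0 < P x)
    (hQ0 : ∀ x, 0 < Q x) (hP1 : ∫⁻ x, ENNReal.ofReal (P x) ∂m = 1)
    (hQ1 : ∫⁻ x, ENNReal.ofReal (Q x) ∂m = 1) {K M : ℝ} (hK : 0 ≤ K) (hM : 0 ≤ M)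
    (hQP : ∀ x, Q x ≤ K * P x)
    (hPQ : ∫⁻ x, ENNReal.ofReal (P x ^ 2 / Q x) ∂m ≤ ENNReal.ofReal (1 + M)) :
    chiSqDiv (m.withDensity fun x => ENNReal.ofReal (Q x))
      (m.withDensity fun x => ENNReal.ofReal (P x)) ≤ ENNReal.ofReal (K * M) := by
  have hPm : Measurable fun x => ENNReal.ofReal (P x) := hP.ennreal_ofReal
  have hr : Measurable fun x => ENNReal.ofReal (Q x / P x) := (hQ.div hP).ennreal_ofReal
  -- Rewriting the first law as a density over the second identifies the Radon–Nikodym derivative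
  -- with `Q / P`.
  have hQeq : (m.withDensity fun x => ENNReal.ofReal (Q x)) =
      (m.withDensity fun x => ENNReal.ofReal (P x)).withDensity
        fun x => ENNReal.ofReal (Q x / P x) := by
    rw [← withDensity_mul _ hPm hr]
    congr 1
    funext x
    rw [Pi.mul_apply, ← ENNReal.ofReal_mul (hP0 x).le, mul_div_cancel₀ _ (hP0 x).ne']
  have hfin : IsFiniteMeasure (m.withDensity fun x => ENNReal.ofReal (P x)) :=
    isFiniteMeasure_withDensity (by rw [hP1]; simp)
  unfold chiSqDiv
  rw [hQeq, if_pos (withDensity_absolutelyContinuous _ _)]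
  have hrn := Measure.rnDeriv_withDensity (m.withDensity fun x => ENNReal.ofReal (P x)) hr
  have h1 : ∫⁻ x, ENNReal.ofReal (((((m.withDensity fun x => ENNReal.ofReal (P x)).withDensity
        fun x => ENNReal.ofReal (Q x / P x)).rnDeriv
        (m.withDensity fun x => ENNReal.ofReal (P x)) x).toReal - 1) ^ 2)
        ∂(m.withDensity fun x => ENNReal.ofReal (P x))
      = ∫⁻ x, ENNReal.ofReal (P x * (Q x / P x - 1) ^ 2) ∂m := by
    rw [lintegral_congr_ae (g := fun x => ENNReal.ofReal ((Q x / P x - 1) ^ 2)),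
      lintegral_withDensity_eq_lintegral_mul _ hPm (by fun_prop)]
    · refine lintegral_congr fun x => ?_
      rw [Pi.mul_apply, ← ENNReal.ofReal_mul (hP0 x).le]
    · filter_upwards [hrn] with x hx
      rw [hx, ENNReal.toReal_ofReal (div_nonneg (hQ0 x).le (hP0 x).le)]
  rw [h1]
  have h2 : ∫⁻ x, ENNReal.ofReal ((P x - Q x) ^ 2 / Q x) ∂m ≤ ENNReal.ofReal M := by
    -- The identity `(P - Q)² / Q + 2P = P² / Q + Q`, arranged without subtraction so that it can be
    -- integrated in `[0, ∞]`.
    have h3 : ∫⁻ x, ENNReal.ofReal ((P x - Q x) ^ 2 / Q x) ∂m + 2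
        = ∫⁻ x, ENNReal.ofReal (P x ^ 2 / Q x) ∂m + 1 := by
      conv_rhs => rw [← hQ1, ← lintegral_add_right _ hQ.ennreal_ofReal]
      have : (2 : ℝ≥0∞) = ∫⁻ x, ENNReal.ofReal (2 * P x) ∂m := by
        simp_rw [ENNReal.ofReal_mul (zero_le_two (α := ℝ))]
        rw [lintegral_const_mul _ hPm, hP1]
        simp
      rw [this, ← lintegral_add_right _ (by fun_prop)]
      refine lintegral_congr fun x => ?_
      have hp := hP0 x
      have hq := hQ0 x
      rw [← ENNReal.ofReal_add (by positivity) (by positivity),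
        ← ENNReal.ofReal_add (by positivity) (by positivity)]
      congr 1
      field_simp
      ring
    have h4 : ∫⁻ x, ENNReal.ofReal ((P x - Q x) ^ 2 / Q x) ∂m + 2 ≤ ENNReal.ofReal M + 2 := by
      rw [h3]
      calc _ ≤ ENNReal.ofReal (1 + M) + 1 := by gcongr
        _ = ENNReal.ofReal M + 2 := by
          rw [ENNReal.ofReal_add zero_le_one hM, ENNReal.ofReal_one, add_comm 1, add_assoc,
            one_add_one_eq_two]
    exact (ENNReal.add_le_add_iff_right (by simp)).1 h4
  calc ∫⁻ x, ENNReal.ofReal (P x * (Q x / P x - 1) ^ 2) ∂m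
      ≤ ∫⁻ x, ENNReal.ofReal K * ENNReal.ofReal ((P x - Q x) ^ 2 / Q x) ∂m := by
        refine lintegral_mono fun x => ?_
        rw [← ENNReal.ofReal_mul hK]
        refine ENNReal.ofReal_le_ofReal ?_
        have hp := hP0 x
        have hq := hQ0 x
        have e1 : P x * (Q x / P x - 1) ^ 2 = (P x - Q x) ^ 2 / P x := by field_simp; ring
        rw [e1, ← mul_div_assoc, div_le_div_iff₀ hp hq]
        nlinarith [mul_le_mul_of_nonneg_left (hQP x) (sq_nonneg (P x - Q x))]
    _ = ENNReal.ofReal K * ∫⁻ x, ENNReal.ofReal ((P x - Q x) ^ 2 / Q x) ∂m :=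
        lintegral_const_mul _ (by fun_prop)
    _ ≤ ENNReal.ofReal (K * M) := by
        rw [ENNReal.ofReal_mul hK]
        gcongr

/-! ### Gaussian integrals -/

theorem one_add_norm_mul_exp_le {E : Type*} [SeminormedAddCommGroup E] (x : E) :
    (1 + ‖x‖) * Real.exp (-‖x‖ ^ 2 / 2) ≤ 2 := by
  have h : 1 + ‖x‖ ≤ 2 * Real.exp (‖x‖ ^ 2 / 2) := by
    nlinarith [Real.add_one_le_exp (‖x‖ ^ 2 / 2), sq_nonneg (‖x‖ - 1)]
  calc (1 + ‖x‖) * Real.exp (-‖x‖ ^ 2 / 2)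
      ≤ 2 * Real.exp (‖x‖ ^ 2 / 2) * Real.exp (-‖x‖ ^ 2 / 2) := by gcongr
    _ = 2 := by rw [mul_assoc, ← Real.exp_add]; ring_nf; simp

section Gaussian

variable {E : Type*} [NormedAddCommGroup E] [InnerProductSpace ℝ E] [FiniteDimensional ℝ E]
  [MeasurableSpace E] [BorelSpace E]

theorem integrable_exp_neg_mul_sq_norm {b : ℝ} (hb : 0 < b) :
    Integrable fun x : E => Real.exp (-b * ‖x‖ ^ 2) := by
  refine Integrable.of_integral_ne_zero ?_
  rw [GaussianFourier.integral_rexp_neg_mul_sq_norm hb]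
  positivity

theorem integrable_one_add_norm_sq_mul_exp :
    Integrable fun x : E => (1 + ‖x‖) ^ 2 * Real.exp (-‖x‖ ^ 2 / 2) := by
  refine ((integrable_exp_neg_mul_sq_norm (E := E) (b := 1 / 4) (by norm_num)).const_mul 8).mono'
    (by fun_prop) (ae_of_all _ fun x => ?_)
  rw [Real.norm_of_nonneg (by positivity)]
  have h1 : Real.exp (-‖x‖ ^ 2 / 2) = Real.exp (-(1 / 4) * ‖x‖ ^ 2) * Real.exp (-(‖x‖ ^ 2 / 4)) := by
    rw [← Real.exp_add]; ring_nf
  have h2 : (1 + ‖x‖) ^ 2 ≤ 8 * Real.exp (‖x‖ ^ 2 / 4) := by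
    nlinarith [Real.add_one_le_exp (‖x‖ ^ 2 / 4), sq_nonneg (‖x‖ - 1)]
  calc (1 + ‖x‖) ^ 2 * Real.exp (-‖x‖ ^ 2 / 2)
      ≤ 8 * Real.exp (‖x‖ ^ 2 / 4) * Real.exp (-‖x‖ ^ 2 / 2) := by gcongr
    _ = 8 * Real.exp (-(1 / 4) * ‖x‖ ^ 2) *
        (Real.exp (‖x‖ ^ 2 / 4) * Real.exp (-(‖x‖ ^ 2 / 4))) := by rw [h1]; ring
    _ = 8 * Real.exp (-(1 / 4) * ‖x‖ ^ 2) := by rw [← Real.exp_add]; simp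

/-- The standard Gaussian measure has density `(2π)^(-n/2) exp(-‖x‖²/2)`. -/
theorem stdGaussian_eq_withDensity :
    stdGaussian E = volume.withDensity fun x => ENNReal.ofReal
      (((2 * Real.pi) ^ (Module.finrank ℝ E / 2 : ℝ))⁻¹ * Real.exp (-‖x‖ ^ 2 / 2)) := by
  set κ : ℝ := (2 * Real.pi) ^ (Module.finrank ℝ E / 2 : ℝ) with hκ
  have hκ0 : 0 < κ := by positivity
  have hexp : ∀ x : E, Real.exp (-‖x‖ ^ 2 / 2) = Real.exp (-(1 / 2) * ‖x‖ ^ 2) := fun x => by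
    ring_nf
  have hint : Integrable fun x : E => κ⁻¹ * Real.exp (-‖x‖ ^ 2 / 2) := by
    simp_rw [hexp]
    exact (integrable_exp_neg_mul_sq_norm (by norm_num)).const_mul _
  have : IsFiniteMeasure (volume.withDensity fun x : E => ENNReal.ofReal
      (κ⁻¹ * Real.exp (-‖x‖ ^ 2 / 2))) := isFiniteMeasure_withDensity_ofReal hint.2
  refine Measure.ext_of_charFun ?_
  funext t
  rw [charFun_stdGaussian, charFun_apply, integral_withDensity_eq_integral_toReal_smul (by fun_prop)
    (ae_of_all _ fun _ => ENNReal.ofReal_lt_top)]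
  -- Fourier transform of the Gaussian: the linear coefficient is `I`, so the exponent on the right
  -- becomes `I² ‖t‖² / (4 · (1/2))`.
  have h := GaussianFourier.integral_cexp_neg_mul_sq_norm_add (V := E) (b := 1 / 2) (by norm_num)
    Complex.I t
  have hk : (Real.pi / (1 / 2) : ℂ) ^ (Module.finrank ℝ E / 2 : ℂ) = (κ : ℂ) := by
    rw [hκ, Complex.ofReal_cpow (by positivity)]
    push_cast
    congr 1
    ring
  rw [hk] at h
  have h2 : ∀ x : E, (ENNReal.ofReal (κ⁻¹ * Real.exp (-‖x‖ ^ 2 / 2))).toReal •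
      Complex.exp ((inner ℝ x t : ℝ) * Complex.I) =
      (κ : ℂ)⁻¹ * Complex.exp (-(1 / 2) * ‖x‖ ^ 2 + Complex.I * (inner ℝ t x : ℝ)) := fun x => by
    rw [ENNReal.toReal_ofReal (by positivity), Complex.exp_add, real_inner_comm, Complex.real_smul]
    push_cast
    rw [mul_assoc]
    congr 3
    · ring
    · ring
  simp_rw [h2]
  rw [integral_const_mul, h, ← mul_assoc, inv_mul_cancel₀ (by exact_mod_cast hκ0.ne'), one_mul]
  congr 1
  rw [Complex.I_sq]
  ring

end Gaussian

/-! ### Integral curves with integrable velocity -/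

/-- The chain rule along an absolutely continuous curve, for an outer function that is
differentiable with a locally bounded derivative. -/
theorem integral_fderiv_apply_eq_sub {E : Type*} [NormedAddCommGroup E] [NormedSpace ℝ E]
    [CompleteSpace E] {h : E → ℝ} (hh : Differentiable ℝ h) {K : ℝ}
    (hK : ∀ x, ‖fderiv ℝ h x‖ ≤ K * (1 + ‖x‖)) {X w : ℝ → E} {a b : ℝ} (hab : a ≤ b)
    (hw : IntervalIntegrable w volume a b)
    (hX : ∀ t ∈ Icc a b, X t = X a + ∫ τ in a..t, w τ) :
    ∫ τ in a..b, fderiv ℝ h (X τ) (w τ) = h (X b) - h (X a) := by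
  have hK0 : 0 ≤ K := by simpa using (norm_nonneg _).trans (hK 0)
  -- `Y` is given by the integral for all times, so it has two-sided derivatives almost everywhere,
  -- whereas `X` is only controlled on `[a, b]`.
  set Y : ℝ → E := fun t => X a + ∫ τ in a..t, w τ with hY
  have hYX : ∀ t ∈ Icc a b, X t = Y t := hX
  have hsub : ∀ s ∈ Icc a b, ∀ t ∈ Icc a b, s ≤ t → IntervalIntegrable w volume s t :=
    fun s hs t ht hst => hw.mono_set (by
      rw [uIcc_of_le hst, uIcc_of_le hab]; exact Icc_subset_Icc hs.1 ht.2)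
  -- Absolute continuity is taken from the real-valued primitive of `‖w‖`, whose increments dominate
  -- those of `Y`, and hence those of `h ∘ Y` up to a Lipschitz constant.
  have hG := hw.norm.absolutelyContinuousOnInterval_intervalIntegral (c := a) (by simp)
  have hYG : ∀ s ∈ Icc a b, ∀ t ∈ Icc a b,
      dist (Y s) (Y t) ≤ dist (∫ τ in a..s, ‖w τ‖) (∫ τ in a..t, ‖w τ‖) := by
    intro s hs t ht
    wlog hst : s ≤ t generalizing s t
    · rw [dist_comm, dist_comm (∫ τ in a..s, ‖w τ‖)]
      exact this t ht s hs (le_of_not_ge hst)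
    have ha : a ∈ Icc a b := left_mem_Icc.2 hab
    rw [dist_comm, dist_comm (∫ τ in a..s, ‖w τ‖), dist_eq_norm, dist_eq_norm]
    have e1 : Y t - Y s = ∫ τ in s..t, w τ := by
      simp only [hY, add_sub_add_left_eq_sub]
      exact intervalIntegral.integral_interval_sub_left (hsub a ha t ht ht.1) (hsub a ha s hs hs.1)
    rw [e1, intervalIntegral.integral_interval_sub_left (hsub a ha t ht ht.1).norm
      (hsub a ha s hs hs.1).norm]
    exact (intervalIntegral.norm_integral_le_integral_norm hst).trans (Real.le_norm_self _)
  have hYc : ContinuousOn Y (Icc a b) := by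
    have := hG.continuousOn
    rw [uIcc_of_le hab] at this
    intro s hs
    refine tendsto_iff_dist_tendsto_zero.2 ?_
    have h1 := tendsto_iff_dist_tendsto_zero.1 (this s hs)
    refine squeeze_zero' (Eventually.of_forall fun _ => dist_nonneg) ?_ h1
    filter_upwards [self_mem_nhdsWithin] with t ht using hYG t ht s hs
  obtain ⟨r, hr⟩ := (isCompact_Icc.image_of_continuousOn hYc).isBounded.subset_ball (0 : E)
  have hYr : ∀ t ∈ Icc a b, Y t ∈ Metric.ball (0 : E) r := fun t ht => hr (mem_image_of_mem _ ht)
  have hLip : ∀ x ∈ Metric.ball (0 : E) r, ∀ y ∈ Metric.ball (0 : E) r,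
      dist (h x) (h y) ≤ K * (1 + r) * dist x y := by
    intro x hx y hy
    rw [dist_eq_norm, dist_eq_norm]
    refine (convex_ball (0 : E) r).norm_image_sub_le_of_norm_fderiv_le (𝕜 := ℝ)
      (fun z _ => hh z) (fun z hz => (hK z).trans ?_) hy hx
    have : ‖z‖ < r := by simpa using hz
    gcongr
  have hr0 : 0 < r := by
    have := hYr a (left_mem_Icc.2 hab)
    exact Metric.pos_of_mem_ball this
  have hAC : AbsolutelyContinuousOnInterval (fun t => h (Y t)) a b := by
    rw [absolutelyContinuousOnInterval_iff] at hG ⊢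
    intro ε hε
    -- The `+ 1` keeps the denominator positive when `K = 0`.
    obtain ⟨δ, hδ, H⟩ := hG (ε / (K * (1 + r) + 1)) (by positivity)
    refine ⟨δ, hδ, fun I hI hIδ => ?_⟩
    have h1 := H I hI hIδ
    have hmem := hI.1
    rw [uIcc_of_le hab] at hmem
    calc ∑ i ∈ Finset.range I.1, dist (h (Y (I.2 i).1)) (h (Y (I.2 i).2))
        ≤ ∑ i ∈ Finset.range I.1, (K * (1 + r) + 1) *
            dist (∫ τ in a..(I.2 i).1, ‖w τ‖) (∫ τ in a..(I.2 i).2, ‖w τ‖) := by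
          refine Finset.sum_le_sum fun i hi => ?_
          have hi' := hmem i hi
          refine (hLip _ (hYr _ hi'.1) _ (hYr _ hi'.2)).trans ?_
          exact mul_le_mul (by linarith) (hYG _ hi'.1 _ hi'.2) dist_nonneg (by positivity)
      _ < ε := by
          rw [← Finset.mul_sum]
          rwa [lt_div_iff₀' (by positivity)] at h1
  have hfin := hAC.integral_deriv_eq_sub
  rw [hYX b (right_mem_Icc.2 hab), hYX a (left_mem_Icc.2 hab), ← hfin]
  refine intervalIntegral.integral_congr_ae ?_
  filter_upwards [hw.ae_hasDerivAt_integral] with t ht htm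
  have htm' : t ∈ uIcc a b := uIoc_subset_uIcc htm
  have hd : HasDerivAt Y (w t) t := (ht htm' a (by simp)).const_add _
  rw [hYX t (by rwa [uIcc_of_le hab] at htm')]
  exact ((hh (Y t)).hasFDerivAt.comp_hasDerivAt t hd).deriv.symm

/-- Grönwall's inequality in integral form. -/
theorem le_mul_exp_of_le_add_integral {u : ℝ → ℝ} {A K : ℝ} (hu : Continuous u) (hK : 0 ≤ K)
    (h : ∀ t ∈ Icc (0 : ℝ) 1, u t ≤ A + K * ∫ τ in (0 : ℝ)..t, u τ) :
    ∀ t ∈ Icc (0 : ℝ) 1, u t ≤ A * Real.exp (K * t) := by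
  set G : ℝ → ℝ := fun t => A + K * ∫ τ in (0 : ℝ)..t, u τ with hG
  have hd : ∀ t, HasDerivAt G (K * u t) t := fun t =>
    ((hu.integral_hasStrictDerivAt 0 t).hasDerivAt.const_mul K).const_add A
  -- The differential inequality is applied to the majorant `G`, which is differentiable with `G' =
  -- K u ≤ K G`; `u` itself is only continuous.
  have := le_gronwallBound_of_liminf_deriv_right_le (f := G) (f' := fun t => K * u t) (δ := A)
    (K := K) (ε := 0) (a := 0) (b := 1) (fun t _ => (hd t).continuousAt.continuousWithinAt)
    (fun t _ r hr => (hd t).hasDerivWithinAt.liminf_right_slope_le hr) (by simp [hG])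
    (fun t ht => by
      rw [add_zero]; exact mul_le_mul_of_nonneg_left (h t (Ico_subset_Icc_self ht)) hK)
  intro t ht
  refine (h t ht).trans ?_
  have h2 := this t ht
  rwa [sub_zero, gronwallBound_ε0] at h2

section Flow

variable {d : ℕ} {v : EuclideanSpace ℝ (Fin d) → ℝ → EuclideanSpace ℝ (Fin d)}
  {Φ : EuclideanSpace ℝ (Fin d) → ℝ → EuclideanSpace ℝ (Fin d)} {Lv : ℝ}

theorem IsFlow.intervalIntegrable (hΦ : IsFlow v Φ) (x : EuclideanSpace ℝ (Fin d)) {a b : ℝ}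
    (ha : a ∈ Icc (0 : ℝ) 1) (hb : b ∈ Icc (0 : ℝ) 1) :
    IntervalIntegrable (fun τ => v (Φ x τ) τ) volume a b :=
  (hΦ x).1.mono_set ((uIcc_subset_Icc ha hb).trans_eq (uIcc_of_le zero_le_one).symm)

theorem IsFlow.eq_add_integral (hΦ : IsFlow v Φ) (x : EuclideanSpace ℝ (Fin d)) {a b : ℝ}
    (ha : a ∈ Icc (0 : ℝ) 1) (hb : b ∈ Icc (0 : ℝ) 1) :
    Φ x b = Φ x a + ∫ τ in a..b, v (Φ x τ) τ := by
  have h0 : (0 : ℝ) ∈ Icc (0 : ℝ) 1 := by simp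
  rw [(hΦ x).2 a ha, (hΦ x).2 b hb, add_assoc, intervalIntegral.integral_add_adjacent_intervals
    (hΦ.intervalIntegrable x h0 ha) (hΦ.intervalIntegrable x ha hb)]

theorem IsFlow.continuousOn (hΦ : IsFlow v Φ) (x : EuclideanSpace ℝ (Fin d)) :
    ContinuousOn (Φ x) (Icc 0 1) := by
  have h : ContinuousOn (fun t => x + ∫ τ in (0 : ℝ)..t, v (Φ x τ) τ) (Icc 0 1) := by
    refine continuousOn_const.add ?_
    have := intervalIntegral.continuousOn_primitive_interval' (hΦ x).1 left_mem_uIcc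
    rwa [uIcc_of_le zero_le_one] at this
  exact h.congr fun t ht => (hΦ x).2 t ht

theorem IsFlow.dist_sub_le (hΦ : IsFlow v Φ) (hcont : ∀ x, Continuous (Φ x))
    (hv : ∀ t ∈ Icc (0 : ℝ) 1, ∀ x y, ‖v x t - v y t‖ ≤ Lv * ‖x - y‖)
    (x y : EuclideanSpace ℝ (Fin d)) {a b : ℝ} (ha : a ∈ Icc (0 : ℝ) 1) (hb : b ∈ Icc (0 : ℝ) 1)
    (hab : a ≤ b) :
    ‖(Φ x b - Φ y b) - (Φ x a - Φ y a)‖ ≤ Lv * ∫ τ in a..b, ‖Φ x τ - Φ y τ‖ := by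
  rw [hΦ.eq_add_integral x ha hb, hΦ.eq_add_integral y ha hb, add_sub_add_comm, add_sub_cancel_left,
    ← intervalIntegral.integral_sub (hΦ.intervalIntegrable x ha hb)
      (hΦ.intervalIntegrable y ha hb), ← intervalIntegral.integral_const_mul]
  refine intervalIntegral.norm_integral_le_of_norm_le hab (ae_of_all _ fun t ht => ?_)
    (Continuous.intervalIntegrable (by have := hcont x; have := hcont y; fun_prop) _ _)
  exact hv t ⟨ha.1.trans ht.1.le, ht.2.trans hb.2⟩ _ _

theorem IsFlow.norm_sub_le (hΦ : IsFlow v Φ) (hcont : ∀ x, Continuous (Φ x)) (hLv : 0 ≤ Lv)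
    (hv : ∀ t ∈ Icc (0 : ℝ) 1, ∀ x y, ‖v x t - v y t‖ ≤ Lv * ‖x - y‖)
    (x y : EuclideanSpace ℝ (Fin d)) {t : ℝ} (ht : t ∈ Icc (0 : ℝ) 1) :
    ‖Φ x t - Φ y t‖ ≤ ‖x - y‖ * Real.exp (Lv * t) := by
  have h0 : (0 : ℝ) ∈ Icc (0 : ℝ) 1 := by simp
  have hz : ∀ z, Φ z 0 = z := fun z => by simpa using (hΦ z).2 0 h0
  refine le_mul_exp_of_le_add_integral (u := fun t => ‖Φ x t - Φ y t‖)
    (by have := hcont x; have := hcont y; fun_prop) hLv (fun s hs => ?_) t ht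
  have h1 := hΦ.dist_sub_le hcont hv x y h0 hs hs.1
  rw [hz, hz] at h1
  have h2 := norm_sub_norm_le (Φ x s - Φ y s) (x - y)
  linarith

/-- Grönwall for the reversed time `1 - t`: separated trajectories cannot merge, which gives
injectivity and a Lipschitz inverse on the range. -/
theorem IsFlow.norm_sub_le_terminal (hΦ : IsFlow v Φ) (hcont : ∀ x, Continuous (Φ x))
    (hLv : 0 ≤ Lv) (hv : ∀ t ∈ Icc (0 : ℝ) 1, ∀ x y, ‖v x t - v y t‖ ≤ Lv * ‖x - y‖)
    (x y : EuclideanSpace ℝ (Fin d)) :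
    ‖x - y‖ ≤ Real.exp Lv * ‖Φ x 1 - Φ y 1‖ := by
  have h0 : (0 : ℝ) ∈ Icc (0 : ℝ) 1 := by simp
  have h1 : (1 : ℝ) ∈ Icc (0 : ℝ) 1 := by simp
  have hz : ∀ z, Φ z 0 = z := fun z => by simpa using (hΦ z).2 0 h0
  have := le_mul_exp_of_le_add_integral (u := fun t => ‖Φ x (1 - t) - Φ y (1 - t)‖)
    (A := ‖Φ x 1 - Φ y 1‖) (K := Lv)
    (by have := hcont x; have := hcont y; fun_prop) hLv (fun s hs => ?_) 1 h1
  · simpa [hz, mul_comm] using this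
  · have hs' : 1 - s ∈ Icc (0 : ℝ) 1 := ⟨by linarith [hs.2], by linarith [hs.1]⟩
    have h2 := hΦ.dist_sub_le hcont hv x y hs' h1 hs'.2
    rw [intervalIntegral.integral_comp_sub_left (fun τ => ‖Φ x τ - Φ y τ‖) 1, sub_zero]
    have h3 := norm_sub_norm_le (Φ x (1 - s) - Φ y (1 - s)) (Φ x 1 - Φ y 1)
    rw [norm_sub_rev] at h2
    linarith

end Flow

/-! ### Density paths transported by a Lipschitz velocity field -/

/-- A flow `Φ` of a Lipschitz field `v` with densities `ρ t` of Gaussian decay and scores of linear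
growth, where `Φ` and `ρ` are defined for all times. -/
structure RegularDensityFlow {d : ℕ} (C₁ L Lv : ℝ) (p : Measure (EuclideanSpace ℝ (Fin d)))
    (v Φ : EuclideanSpace ℝ (Fin d) → ℝ → EuclideanSpace ℝ (Fin d))
    (ρ : ℝ → EuclideanSpace ℝ (Fin d) → ℝ) : Prop where
  measurable_field : Measurable (Function.uncurry v)
  isFlow : IsFlow v Φ
  lipschitz : ∀ t ∈ Icc (0 : ℝ) 1, ∀ x y, ‖v x t - v y t‖ ≤ Lv * ‖x - y‖
  continuous_time : ∀ x, Continuous (Φ x)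
  continuous_space : ∀ t, Continuous fun x => Φ x t
  map_eq : ∀ t, p.map (fun x => Φ x t) = volume.withDensity (fun x => ENNReal.ofReal (ρ t x))
  pos : ∀ t x, 0 < ρ t x
  le : ∀ t x, ρ t x ≤ C₁ * Real.exp (-‖x‖ ^ 2 / 2)
  differentiable : ∀ t, Differentiable ℝ (ρ t)
  norm_fderiv_le : ∀ t x, ‖fderiv ℝ (ρ t) x‖ ≤ L * (1 + ‖x‖) * ρ t x

namespace RegularDensityFlow

variable {d : ℕ} {C₁ L Lv : ℝ} {p : Measure (EuclideanSpace ℝ (Fin d))}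
  {v Φ : EuclideanSpace ℝ (Fin d) → ℝ → EuclideanSpace ℝ (Fin d)}
  {ρ : ℝ → EuclideanSpace ℝ (Fin d) → ℝ}

theorem integral_comp_flow (H : RegularDensityFlow C₁ L Lv p v Φ ρ) (t : ℝ)
    {h : EuclideanSpace ℝ (Fin d) → ℝ} (hh : Measurable h) :
    ∫ x, h (Φ x t) ∂p = ∫ x, h x * ρ t x := by
  rw [← integral_map (μ := p) (φ := fun x => Φ x t) (f := h)
    (H.continuous_space t).measurable.aemeasurable hh.aestronglyMeasurable, H.map_eq,
    integral_withDensity_eq_integral_toReal_smul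
      (H.differentiable t).continuous.measurable.ennreal_ofReal
      (ae_of_all _ fun _ => ENNReal.ofReal_lt_top)]
  refine integral_congr_ae (ae_of_all _ fun x => ?_)
  simp only [ENNReal.toReal_ofReal (H.pos t x).le, smul_eq_mul, mul_comm]

theorem lintegral_comp_flow (H : RegularDensityFlow C₁ L Lv p v Φ ρ) (t : ℝ)
    {h : EuclideanSpace ℝ (Fin d) → ℝ≥0∞} (hh : Measurable h) :
    ∫⁻ x, h (Φ x t) ∂p = ∫⁻ x, h x * ENNReal.ofReal (ρ t x) := by
  have hm := (H.differentiable t).continuous.measurable.ennreal_ofReal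
  rw [← lintegral_map (μ := p) (g := fun x => Φ x t) (f := h) hh
    (H.continuous_space t).measurable, H.map_eq,
    lintegral_withDensity_eq_lintegral_mul _ hm hh]
  simp_rw [Pi.mul_apply, mul_comm]

theorem lintegral_density [IsProbabilityMeasure p] (H : RegularDensityFlow C₁ L Lv p v Φ ρ)
    (t : ℝ) : ∫⁻ x, ENNReal.ofReal (ρ t x) = 1 := by
  have := H.lintegral_comp_flow t (h := fun _ => 1) measurable_const
  simpa using this.symm

theorem integrable_density [IsProbabilityMeasure p] (H : RegularDensityFlow C₁ L Lv p v Φ ρ)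
    (t : ℝ) : Integrable (ρ t) := by
  refine ⟨(H.differentiable t).continuous.aestronglyMeasurable, ?_⟩
  rw [hasFiniteIntegral_iff_ofReal (ae_of_all _ fun x => (H.pos t x).le), H.lintegral_density t]
  simp

theorem integral_density [IsProbabilityMeasure p] (H : RegularDensityFlow C₁ L Lv p v Φ ρ)
    (t : ℝ) : ∫ x, ρ t x = 1 := by
  have := H.integral_comp_flow t (h := fun _ => 1) measurable_const
  simpa using this.symm

theorem const_nonneg (H : RegularDensityFlow C₁ L Lv p v Φ ρ) : 0 ≤ C₁ := by
  have h1 := (H.pos 0 0).trans_le (H.le 0 0)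
  simp only [norm_zero] at h1
  norm_num at h1
  exact h1.le

theorem score_const_nonneg (H : RegularDensityFlow C₁ L Lv p v Φ ρ) : 0 ≤ L := by
  have h1 := (norm_nonneg _).trans (H.norm_fderiv_le 0 0)
  simp only [norm_zero, add_zero, mul_one] at h1
  exact nonneg_of_mul_nonneg_left h1 (H.pos 0 0)

/-- The Gaussian decay of the density absorbs the linear growth of the score. The Lipschitz constant
does not depend on `t`, which is the equicontinuity used for continuity in time. -/
theorem abs_sub_le (H : RegularDensityFlow C₁ L Lv p v Φ ρ) (t : ℝ)
    (x y : EuclideanSpace ℝ (Fin d)) : |ρ t x - ρ t y| ≤ 2 * L * C₁ * ‖x - y‖ := by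
  have hC := H.const_nonneg
  have hL := H.score_const_nonneg
  refine convex_univ.norm_image_sub_le_of_norm_fderiv_le (𝕜 := ℝ)
    (fun z _ => H.differentiable t z) (fun z _ => (H.norm_fderiv_le t z).trans ?_)
    (mem_univ y) (mem_univ x)
  calc L * (1 + ‖z‖) * ρ t z ≤ L * (1 + ‖z‖) * (C₁ * Real.exp (-‖z‖ ^ 2 / 2)) := by
        gcongr; exact H.le t z
    _ = L * C₁ * ((1 + ‖z‖) * Real.exp (-‖z‖ ^ 2 / 2)) := by ring
    _ ≤ L * C₁ * 2 := by gcongr; exact one_add_norm_mul_exp_le z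
    _ = 2 * L * C₁ := by ring

/-- The densities are continuous in time, by weak continuity and equicontinuity in space. -/
theorem continuous_density [IsProbabilityMeasure p] (H : RegularDensityFlow C₁ L Lv p v Φ ρ)
    (x : EuclideanSpace ℝ (Fin d)) : Continuous fun t => ρ t x := by
  have hC := H.const_nonneg
  have hL := H.score_const_nonneg
  refine continuous_of_uniform_approx_of_continuous fun u hu => ?_
  obtain ⟨ε, hε, hεu⟩ := Metric.mem_uniformity_dist.1 hu
  -- With this radius the Lipschitz bound gives `2 L C₁ r ≤ ε / 2`, so averaging against a bump of
  -- radius `r` changes the density by less than `ε`, uniformly in time.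
  set r : ℝ := ε / (2 * L * C₁ + 1) / 2 with hr
  have hr0 : 0 < r := by positivity
  let f : ContDiffBump x := ⟨r / 2, r, by positivity, by linarith⟩
  have hψc : Continuous (f.normed volume) := f.continuous_normed
  obtain ⟨B, hB⟩ := hψc.bounded_above_of_compact_support f.hasCompactSupport_normed
  have hψi : Integrable (f.normed (volume : Measure (EuclideanSpace ℝ (Fin d)))) :=
    f.integrable_normed
  have hprod : ∀ t, Integrable fun y => f.normed volume y * ρ t y := fun t =>
    (H.integrable_density t).bdd_mul hψc.aestronglyMeasurable (ae_of_all _ hB)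
  refine ⟨fun t => ∫ y, f.normed volume y * ρ t y, ?_, fun t => hεu ?_⟩
  · simp_rw [← H.integral_comp_flow _ hψc.measurable]
    refine continuous_of_dominated (bound := fun _ => B) (fun t => ?_)
      (fun t => ae_of_all _ fun y => hB _) (integrable_const _) (ae_of_all _ fun y => ?_)
    · exact (hψc.comp (H.continuous_space t)).aestronglyMeasurable
    · exact hψc.comp (H.continuous_time y)
  · have h1 : ρ t x = ∫ y, f.normed volume y * ρ t x := by
      rw [integral_mul_const, f.integral_normed, one_mul]
    rw [h1, dist_eq_norm, ← integral_sub (hψi.mul_const _) (hprod t)]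
    have h2 : ∀ y, ‖f.normed volume y * ρ t x - f.normed volume y * ρ t y‖
        ≤ f.normed volume y * (2 * L * C₁ * r) := fun y => by
      rw [← mul_sub, norm_mul, Real.norm_of_nonneg (f.nonneg_normed y)]
      by_cases hy : y ∈ Metric.ball x r
      · refine mul_le_mul_of_nonneg_left ?_ (f.nonneg_normed y)
        refine (H.abs_sub_le t x y).trans ?_
        have : ‖x - y‖ < r := by rw [← dist_eq_norm, dist_comm]; exact hy
        gcongr
      · have : f.normed volume y = 0 := by
          rw [← Function.notMem_support, f.support_normed_eq]; exact hy
        rw [this]; simp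
    calc _ ≤ ∫ y, f.normed volume y * (2 * L * C₁ * r) :=
          norm_integral_le_of_norm_le (hψi.mul_const _) (ae_of_all _ h2)
      _ = 2 * L * C₁ * r := by rw [integral_mul_const, f.integral_normed, one_mul]
      _ < ε := by
          have : (2 * L * C₁ + 1) * r = ε / 2 := by rw [hr]; field_simp
          nlinarith

theorem measurable_density [IsProbabilityMeasure p] (H : RegularDensityFlow C₁ L Lv p v Φ ρ) :
    Measurable fun z : ℝ × EuclideanSpace ℝ (Fin d) => ρ z.1 z.2 :=
  measurable_uncurry_of_continuous_of_measurable (u := ρ) H.continuous_density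
    fun t => (H.differentiable t).continuous.measurable

theorem measurable_flow (H : RegularDensityFlow C₁ L Lv p v Φ ρ) :
    Measurable fun z : ℝ × EuclideanSpace ℝ (Fin d) => Φ z.2 z.1 :=
  measurable_uncurry_of_continuous_of_measurable (u := fun t x => Φ x t) H.continuous_time
    fun t => (H.continuous_space t).measurable

theorem measurable_field_swap (H : RegularDensityFlow C₁ L Lv p v Φ ρ) :
    Measurable fun z : ℝ × EuclideanSpace ℝ (Fin d) => v z.2 z.1 :=
  H.measurable_field.comp measurable_swap

/-- Integrability in time is known only along trajectories; the Lipschitz condition transfers it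
from the trajectory of `0` to the fixed point `0`. -/
theorem integrable_field_zero (H : RegularDensityFlow C₁ L Lv p v Φ ρ) :
    Integrable (fun t => ‖v 0 t‖) (volume.restrict (Ioc 0 1)) := by
  have h1 : Integrable (fun t => v (Φ 0 t) t) (volume.restrict (Ioc 0 1)) :=
    (intervalIntegrable_iff_integrableOn_Ioc_of_le zero_le_one).1 (H.isFlow 0).1
  have h2 : Integrable (fun t => Lv * ‖Φ 0 t‖) (volume.restrict (Ioc 0 1)) :=
    (intervalIntegrable_iff_integrableOn_Ioc_of_le zero_le_one).1
      (Continuous.intervalIntegrable (by have := H.continuous_time 0; fun_prop) _ _)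
  have hm : Measurable fun t => ‖v 0 t‖ :=
    (H.measurable_field_swap.comp (measurable_id.prodMk measurable_const)).norm
  refine (h1.norm.add h2).mono' hm.aestronglyMeasurable ?_
  refine (ae_restrict_iff' measurableSet_Ioc).2 (ae_of_all _ fun t ht => ?_)
  have h3 := H.lipschitz t (Ioc_subset_Icc_self ht) 0 (Φ 0 t)
  rw [zero_sub, norm_neg] at h3
  rw [norm_norm]
  have h4 := norm_sub_norm_le (v 0 t) (v (Φ 0 t) t)
  simp only [Pi.add_apply]
  linarith

/-- The field has finite first moment against a Gaussian weight of linear growth. -/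
theorem integrable_weighted_field (H : RegularDensityFlow C₁ L Lv p v Φ ρ) (hLv : 0 ≤ Lv) :
    Integrable (fun z : ℝ × EuclideanSpace ℝ (Fin d) =>
      (1 + ‖z.2‖) * ‖v z.2 z.1‖ * Real.exp (-‖z.2‖ ^ 2 / 2))
      ((volume.restrict (Ioc 0 1)).prod volume) := by
  have h1 : Integrable (fun t => ‖v 0 t‖ + Lv) (volume.restrict (Ioc 0 1)) :=
    H.integrable_field_zero.add (integrable_const _)
  have hm := H.measurable_field_swap
  refine (h1.mul_prod (integrable_one_add_norm_sq_mul_exp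
    (E := EuclideanSpace ℝ (Fin d)))).mono'
    (((measurable_const.add measurable_snd.norm).mul hm.norm).mul
      (by fun_prop)).aestronglyMeasurable ?_
  have hmem : ∀ᵐ z : ℝ × EuclideanSpace ℝ (Fin d) ∂((volume.restrict (Ioc 0 1)).prod volume),
      z.1 ∈ Ioc (0 : ℝ) 1 :=
    Measure.quasiMeasurePreserving_fst.ae (ae_restrict_mem measurableSet_Ioc)
  filter_upwards [hmem] with z hz
  rw [Real.norm_of_nonneg (by positivity)]
  have h3 := H.lipschitz z.1 (Ioc_subset_Icc_self hz) z.2 0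
  rw [sub_zero] at h3
  have h4 := norm_sub_norm_le (v z.2 z.1) (v 0 z.1)
  have h5 : ‖v z.2 z.1‖ ≤ (‖v 0 z.1‖ + Lv) * (1 + ‖z.2‖) := by
    nlinarith [norm_nonneg (v 0 z.1), norm_nonneg z.2,
      mul_nonneg (norm_nonneg (v 0 z.1)) (norm_nonneg z.2)]
  calc (1 + ‖z.2‖) * ‖v z.2 z.1‖ * Real.exp (-‖z.2‖ ^ 2 / 2)
      ≤ (1 + ‖z.2‖) * ((‖v 0 z.1‖ + Lv) * (1 + ‖z.2‖)) * Real.exp (-‖z.2‖ ^ 2 / 2) := by gcongr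
    _ = _ := by ring

theorem measurable_fderiv_apply (H : RegularDensityFlow C₁ L Lv p v Φ ρ)
    (h : EuclideanSpace ℝ (Fin d) → ℝ) :
    Measurable fun z : ℝ × EuclideanSpace ℝ (Fin d) => fderiv ℝ h z.2 (v z.2 z.1) := by
  have h1 : Measurable fun z : ℝ × EuclideanSpace ℝ (Fin d) =>
      (fderiv ℝ h z.2, v z.2 z.1) :=
    ((measurable_fderiv ℝ h).comp measurable_snd).prodMk H.measurable_field_swap
  exact (isBoundedBilinearMap_apply (𝕜 := ℝ) (E := EuclideanSpace ℝ (Fin d))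
    (F := ℝ)).continuous.measurable.comp h1

theorem integrable_fderiv_mul_density [IsProbabilityMeasure p]
    (H : RegularDensityFlow C₁ L Lv p v Φ ρ) (hLv : 0 ≤ Lv)
    {h : EuclideanSpace ℝ (Fin d) → ℝ} {K : ℝ} (hK : ∀ x, ‖fderiv ℝ h x‖ ≤ K * (1 + ‖x‖)) :
    Integrable (fun z : ℝ × EuclideanSpace ℝ (Fin d) =>
      fderiv ℝ h z.2 (v z.2 z.1) * ρ z.1 z.2) ((volume.restrict (Ioc 0 1)).prod volume) := by
  refine ((H.integrable_weighted_field hLv).const_mul (K * C₁)).mono'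
    ((H.measurable_fderiv_apply h).mul H.measurable_density).aestronglyMeasurable
    (ae_of_all _ fun z => ?_)
  have hK0 : 0 ≤ K * (1 + ‖z.2‖) := (norm_nonneg _).trans (hK z.2)
  rw [norm_mul, Real.norm_of_nonneg (H.pos z.1 z.2).le]
  calc ‖fderiv ℝ h z.2 (v z.2 z.1)‖ * ρ z.1 z.2
      ≤ K * (1 + ‖z.2‖) * ‖v z.2 z.1‖ * (C₁ * Real.exp (-‖z.2‖ ^ 2 / 2)) := by
        refine mul_le_mul ?_ (H.le _ _) (H.pos _ _).le (by positivity)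
        exact ((fderiv ℝ h z.2).le_opNorm _).trans (by gcongr; exact hK _)
    _ = _ := by ring

/-- The continuity equation tested against a bounded differentiable function. -/
theorem integral_mul_density_sub [IsProbabilityMeasure p]
    (H : RegularDensityFlow C₁ L Lv p v Φ ρ) (hLv : 0 ≤ Lv)
    {h : EuclideanSpace ℝ (Fin d) → ℝ} (hh : Differentiable ℝ h) {B K : ℝ} (hB : ∀ x, ‖h x‖ ≤ B)
    (hK : ∀ x, ‖fderiv ℝ h x‖ ≤ K * (1 + ‖x‖)) {a b : ℝ} (ha : 0 ≤ a) (hab : a ≤ b) (hb : b ≤ 1) :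
    (∫ x, h x * ρ b x) - ∫ x, h x * ρ a x =
      ∫ z : ℝ × EuclideanSpace ℝ (Fin d), fderiv ℝ h z.2 (v z.2 z.1) * ρ z.1 z.2
        ∂((volume.restrict (Ioc a b)).prod volume) := by
  have hle : volume.restrict (Ioc a b) ≤ volume.restrict (Ioc (0 : ℝ) 1) :=
    Measure.restrict_mono (Ioc_subset_Ioc ha hb) le_rfl
  have hint := (H.integrable_fderiv_mul_density hLv hK).mono_measure
    (Measure.prod_mono hle (le_refl (volume : Measure (EuclideanSpace ℝ (Fin d)))))
  have hmk : Measurable fun z : ℝ × EuclideanSpace ℝ (Fin d) =>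
      fderiv ℝ h (Φ z.2 z.1) (v (Φ z.2 z.1) z.1) :=
    (H.measurable_fderiv_apply h).comp (measurable_fst.prodMk H.measurable_flow)
  have hk : ∀ t, Measurable fun x => fderiv ℝ h x (v x t) := fun t =>
    (H.measurable_fderiv_apply h).comp (measurable_const.prodMk measurable_id)
  have hintp : Integrable (fun z : ℝ × EuclideanSpace ℝ (Fin d) =>
      fderiv ℝ h (Φ z.2 z.1) (v (Φ z.2 z.1) z.1)) ((volume.restrict (Ioc a b)).prod p) := by
    -- For each time the law of the flow is `ρ t`, so the absolute moment under `p` equals the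
    -- spatial integral already known to be finite.
    refine ⟨hmk.aestronglyMeasurable, ?_⟩
    have h1 := hint.2
    rw [HasFiniteIntegral, lintegral_prod _ (by
      exact ((H.measurable_fderiv_apply h).mul H.measurable_density).enorm.aemeasurable)] at h1
    rw [HasFiniteIntegral, lintegral_prod _ hmk.enorm.aemeasurable]
    refine lt_of_eq_of_lt (lintegral_congr fun t => ?_) h1
    rw [H.lintegral_comp_flow t (h := fun x => ‖fderiv ℝ h x (v x t)‖ₑ) (hk t).enorm]
    refine lintegral_congr fun x => ?_
    rw [enorm_mul, Real.enorm_of_nonneg (H.pos t x).le]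
  have hbd : ∀ t, Integrable (fun x => h (Φ x t)) p := fun t =>
    Integrable.of_bound (hh.continuous.comp (H.continuous_space t)).aestronglyMeasurable B
      (ae_of_all _ fun x => hB _)
  have ha' : a ∈ Icc (0 : ℝ) 1 := ⟨ha, hab.trans hb⟩
  have hb' : b ∈ Icc (0 : ℝ) 1 := ⟨ha.trans hab, hb⟩
  rw [← H.integral_comp_flow b hh.continuous.measurable,
    ← H.integral_comp_flow a hh.continuous.measurable, ← integral_sub (hbd b) (hbd a),
    integral_prod _ hint]
  have hchain : ∀ x, h (Φ x b) - h (Φ x a) =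
      ∫ t in Ioc a b, fderiv ℝ h (Φ x t) (v (Φ x t) t) := fun x => by
    rw [← intervalIntegral.integral_of_le hab]
    exact (integral_fderiv_apply_eq_sub hh hK hab (H.isFlow.intervalIntegrable x ha' hb')
      fun t ht => H.isFlow.eq_add_integral x ha' ⟨ha.trans ht.1, ht.2.trans hb⟩).symm
  simp_rw [hchain]
  rw [integral_integral_swap (f := fun x t => fderiv ℝ h (Φ x t) (v (Φ x t) t)) hintp.swap]
  refine integral_congr_ae (ae_of_all _ fun t => ?_)
  exact H.integral_comp_flow t (hk t)

end RegularDensityFlow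

/-! ### Damped density ratios -/

/-- The density ratio `P / Q`, damped so that it is bounded by `1 / δ`. -/
noncomputable def dampedRatio {α : Type*} (δ : ℝ) (P Q : α → ℝ) (x : α) : ℝ :=
  P x / (Q x + δ * P x)

section DampedRatio

variable {α : Type*} {δ : ℝ} {P Q : α → ℝ} {x : α}

theorem dampedRatio_nonneg (hδ : 0 < δ) (hP : 0 < P x) (hQ : 0 < Q x) :
    0 ≤ dampedRatio δ P Q x := by
  unfold dampedRatio; positivity

theorem dampedRatio_le_inv (hδ : 0 < δ) (hP : 0 < P x) (hQ : 0 < Q x) :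
    dampedRatio δ P Q x ≤ δ⁻¹ := by
  unfold dampedRatio
  rw [div_le_iff₀ (by positivity), mul_add, inv_mul_cancel_left₀ hδ.ne']
  have : 0 < δ⁻¹ * Q x := by positivity
  linarith

theorem dampedRatio_le_div (hδ : 0 < δ) (hP : 0 < P x) (hQ : 0 < Q x) :
    dampedRatio δ P Q x ≤ P x / Q x := by
  unfold dampedRatio
  have : 0 < δ * P x := by positivity
  gcongr
  linarith

theorem one_sub_mul_dampedRatio (hδ : 0 < δ) (hP : 0 < P x) (hQ : 0 < Q x) :
    (1 - δ * dampedRatio δ P Q x) * P x = dampedRatio δ P Q x * Q x := by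
  unfold dampedRatio
  have : Q x + δ * P x ≠ 0 := by positivity
  field_simp
  ring

theorem one_sub_mul_dampedRatio_mem (hδ : 0 < δ) (hP : 0 < P x) (hQ : 0 < Q x) :
    1 - δ * dampedRatio δ P Q x ∈ Icc (0 : ℝ) 1 := by
  have h1 := dampedRatio_le_inv hδ hP hQ
  have h2 := mul_nonneg hδ.le (dampedRatio_nonneg hδ hP hQ)
  have h3 : δ * dampedRatio δ P Q x ≤ 1 := by
    simpa [hδ.ne'] using mul_le_mul_of_nonneg_left h1 hδ.le
  constructor <;> linarith

/-- The variational inequality for `a² / (b + δ a)`. -/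
theorem two_mul_sub_sq_le_dampedRatio_mul (hδ : 0 < δ) (hP : 0 < P x) (hQ : 0 < Q x) (s : ℝ) :
    (2 * s - δ * s ^ 2) * P x - s ^ 2 * Q x ≤ dampedRatio δ P Q x * P x := by
  unfold dampedRatio
  rw [div_mul_eq_mul_div, le_div_iff₀ (by positivity)]
  nlinarith [sq_nonneg (P x - s * (Q x + δ * P x))]

/-- The case `s = dampedRatio δ P Q x` of the variational inequality, where the completed square
vanishes. -/
theorem dampedRatio_mul_eq (hδ : 0 < δ) (hP : 0 < P x) (hQ : 0 < Q x) :
    dampedRatio δ P Q x * P x =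
      (2 * dampedRatio δ P Q x - δ * dampedRatio δ P Q x ^ 2) * P x -
        dampedRatio δ P Q x ^ 2 * Q x := by
  linear_combination (-dampedRatio δ P Q x) * one_sub_mul_dampedRatio hδ hP hQ

variable {E : Type*} [NormedAddCommGroup E] [NormedSpace ℝ E] {f g : E → ℝ}

theorem hasFDerivAt_dampedRatio (hδ : 0 < δ) (hf : Differentiable ℝ f) (hg : Differentiable ℝ g)
    (hf0 : ∀ x, 0 < f x) (hg0 : ∀ x, 0 < g x) (x : E) :
    HasFDerivAt (dampedRatio δ f g)
      (((g x + δ * f x) ^ 2)⁻¹ • (g x • fderiv ℝ f x - f x • fderiv ℝ g x)) x := by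
  have hne : g x + δ * f x ≠ 0 := by have := hf0 x; have := hg0 x; positivity
  have hden : HasFDerivAt (fun y => g y + δ * f y) (fderiv ℝ g x + δ • fderiv ℝ f x) x :=
    (hg x).hasFDerivAt.add ((hf x).hasFDerivAt.const_mul δ)
  have h := (hf x).hasFDerivAt.mul ((hasDerivAt_inv hne).comp_hasFDerivAt x hden)
  refine (h.congr_fderiv ?_).congr_of_eventuallyEq (Eventually.of_forall fun y => ?_)
  · ext y
    simp only [smul_apply, sub_apply, add_apply, smul_eq_mul, Function.comp_apply]
    field_simp
    ring
  · simp [dampedRatio, div_eq_mul_inv]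

theorem differentiable_dampedRatio (hδ : 0 < δ) (hf : Differentiable ℝ f) (hg : Differentiable ℝ g)
    (hf0 : ∀ x, 0 < f x) (hg0 : ∀ x, 0 < g x) : Differentiable ℝ (dampedRatio δ f g) :=
  fun x => (hasFDerivAt_dampedRatio hδ hf hg hf0 hg0 x).differentiableAt

/-- The gradient is a difference of two logarithmic gradients weighted by `f g / (g + δ f)²`, and
damping only enlarges the denominator. The constant is thus the one for `f / g`, free of `δ`. -/
theorem norm_fderiv_dampedRatio_le (hδ : 0 < δ) (hf : Differentiable ℝ f)
    (hg : Differentiable ℝ g) (hf0 : ∀ x, 0 < f x) (hg0 : ∀ x, 0 < g x) {x : E} {S : ℝ}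
    (hS : 0 ≤ S) (hfS : ‖fderiv ℝ f x‖ ≤ S * f x) (hgS : ‖fderiv ℝ g x‖ ≤ S * g x) :
    ‖fderiv ℝ (dampedRatio δ f g) x‖ ≤ 2 * S * dampedRatio δ f g x := by
  have h1 := hf0 x
  have h2 := hg0 x
  rw [(hasFDerivAt_dampedRatio hδ hf hg hf0 hg0 x).fderiv, norm_smul, norm_inv, norm_pow,
    Real.norm_of_nonneg (by positivity)]
  have h3 : ‖g x • fderiv ℝ f x - f x • fderiv ℝ g x‖ ≤ 2 * S * (f x * g x) := by
    refine (norm_sub_le _ _).trans ?_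
    rw [norm_smul, norm_smul, Real.norm_of_nonneg h1.le, Real.norm_of_nonneg h2.le]
    nlinarith [mul_le_mul_of_nonneg_left hfS h2.le, mul_le_mul_of_nonneg_left hgS h1.le]
  calc _ ≤ ((g x + δ * f x) ^ 2)⁻¹ * (2 * S * (f x * g x)) := by gcongr
    _ ≤ ((g x + δ * f x) ^ 2)⁻¹ * (2 * S * (f x * (g x + δ * f x))) := by
        gcongr
        nlinarith
    _ = _ := by unfold dampedRatio; field_simp

end DampedRatio

/-! ### Evolution of the damped divergence between two density flows -/

section TwoFlows

variable {d : ℕ} {C₁ L Lv δ : ℝ} {p : Measure (EuclideanSpace ℝ (Fin d))}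
  {v Φ v' Φ' : EuclideanSpace ℝ (Fin d) → ℝ → EuclideanSpace ℝ (Fin d)}
  {ρ ρ' : ℝ → EuclideanSpace ℝ (Fin d) → ℝ}

/-- The bound at time `z.1` and place `z.2` for the growth of the divergence of the two density
paths when it is tested with the damped ratio of the densities at time `t`. -/
noncomputable def growthBound (δ L : ℝ)
    (v v' : EuclideanSpace ℝ (Fin d) → ℝ → EuclideanSpace ℝ (Fin d))
    (ρ ρ' : ℝ → EuclideanSpace ℝ (Fin d) → ℝ) (t : ℝ) (z : ℝ × EuclideanSpace ℝ (Fin d)) : ℝ :=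
  4 * L * (1 + ‖z.2‖) * dampedRatio δ (ρ t) (ρ' t) z.2 *
    (ρ z.1 z.2 * ‖v z.2 z.1 - v' z.2 z.1‖ + ‖v' z.2 z.1‖ *
      |(1 - δ * dampedRatio δ (ρ t) (ρ' t) z.2) * ρ z.1 z.2 -
        dampedRatio δ (ρ t) (ρ' t) z.2 * ρ' z.1 z.2|)

theorem growthBound_nonneg (H : RegularDensityFlow C₁ L Lv p v Φ ρ)
    (H' : RegularDensityFlow C₁ L Lv p v' Φ' ρ') (hδ : 0 < δ) (t : ℝ)
    (z : ℝ × EuclideanSpace ℝ (Fin d)) : 0 ≤ growthBound δ L v v' ρ ρ' t z := by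
  have h1 := dampedRatio_nonneg hδ (H.pos t z.2) (H'.pos t z.2)
  have h2 := H.score_const_nonneg
  have h3 := (H.pos z.1 z.2).le
  unfold growthBound
  positivity

/-- A crude majorant that degenerates as `δ → 0` but does not depend on the frozen time `t`: it
serves only for integrability and dominated convergence. -/
theorem growthBound_le (H : RegularDensityFlow C₁ L Lv p v Φ ρ)
    (H' : RegularDensityFlow C₁ L Lv p v' Φ' ρ') (hδ : 0 < δ) (t : ℝ)
    (z : ℝ × EuclideanSpace ℝ (Fin d)) :
    growthBound δ L v v' ρ ρ' t z ≤ 4 * L * δ⁻¹ * C₁ *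
      ((1 + ‖z.2‖) * ‖v z.2 z.1‖ * Real.exp (-‖z.2‖ ^ 2 / 2)) + 4 * L * δ⁻¹ * C₁ * (2 + δ⁻¹) *
      ((1 + ‖z.2‖) * ‖v' z.2 z.1‖ * Real.exp (-‖z.2‖ ^ 2 / 2)) := by
  have h1 := dampedRatio_nonneg hδ (H.pos t z.2) (H'.pos t z.2)
  have h2 := H.score_const_nonneg
  have hC := H.const_nonneg
  have h3 := dampedRatio_le_inv hδ (H.pos t z.2) (H'.pos t z.2)
  have h4 := one_sub_mul_dampedRatio_mem hδ (H.pos t z.2) (H'.pos t z.2)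
  have hP := H.pos z.1 z.2
  have hQ := H'.pos z.1 z.2
  have hPle := H.le z.1 z.2
  have hQle := H'.le z.1 z.2
  have hv := norm_sub_le (v z.2 z.1) (v' z.2 z.1)
  unfold growthBound
  generalize dampedRatio δ (ρ t) (ρ' t) z.2 = g at *
  generalize Real.exp (-‖z.2‖ ^ 2 / 2) = e at *
  have h5 : |(1 - δ * g) * ρ z.1 z.2 - g * ρ' z.1 z.2| ≤ C₁ * e + δ⁻¹ * (C₁ * e) := by
    refine (abs_sub _ _).trans ?_
    rw [abs_of_nonneg (mul_nonneg h4.1 hP.le), abs_of_nonneg (by positivity)]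
    refine add_le_add ?_ (by gcongr)
    nlinarith [h4.2]
  have hCe : 0 ≤ C₁ * e := hP.le.trans hPle
  calc _ ≤ 4 * L * (1 + ‖z.2‖) * δ⁻¹ * (C₁ * e * (‖v z.2 z.1‖ + ‖v' z.2 z.1‖) +
        ‖v' z.2 z.1‖ * (C₁ * e + δ⁻¹ * (C₁ * e))) := by gcongr
    _ = _ := by ring

theorem measurable_dampedRatio [IsProbabilityMeasure p] (H : RegularDensityFlow C₁ L Lv p v Φ ρ)
    (H' : RegularDensityFlow C₁ L Lv p v' Φ' ρ') {c : ℝ → ℝ} (hc : Measurable c) :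
    Measurable fun z : ℝ × EuclideanSpace ℝ (Fin d) =>
      dampedRatio δ (ρ (c z.1)) (ρ' (c z.1)) z.2 := by
  have hm : Measurable fun z : ℝ × EuclideanSpace ℝ (Fin d) => (c z.1, z.2) :=
    (hc.comp measurable_fst).prodMk measurable_snd
  have h1 := H.measurable_density.comp hm
  have h2 := H'.measurable_density.comp hm
  exact h1.div (h2.add (h1.const_mul δ))

theorem measurable_growthBound [IsProbabilityMeasure p] (H : RegularDensityFlow C₁ L Lv p v Φ ρ)
    (H' : RegularDensityFlow C₁ L Lv p v' Φ' ρ') {c : ℝ → ℝ} (hc : Measurable c) :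
    Measurable fun z : ℝ × EuclideanSpace ℝ (Fin d) =>
      growthBound δ L v v' ρ ρ' (c z.1) z := by
  have hg := measurable_dampedRatio (δ := δ) H H' hc
  have h1 := H.measurable_density
  have h2 := H'.measurable_density
  have h3 := H.measurable_field_swap
  have h4 := H'.measurable_field_swap
  have h5 : Measurable fun z : ℝ × EuclideanSpace ℝ (Fin d) => 4 * L * (1 + ‖z.2‖) := by fun_prop
  exact (h5.mul hg).mul ((h1.mul (h3.sub h4).norm).add (h4.norm.mul
    (continuous_abs.measurable.comp
      (((measurable_const.sub (hg.const_mul δ)).mul h1).sub (hg.mul h2)))))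

theorem integrable_growthBound_majorant (H : RegularDensityFlow C₁ L Lv p v Φ ρ)
    (H' : RegularDensityFlow C₁ L Lv p v' Φ' ρ') (hLv : 0 ≤ Lv) (A A' : ℝ) :
    Integrable (fun z : ℝ × EuclideanSpace ℝ (Fin d) =>
      A * ((1 + ‖z.2‖) * ‖v z.2 z.1‖ * Real.exp (-‖z.2‖ ^ 2 / 2)) +
      A' * ((1 + ‖z.2‖) * ‖v' z.2 z.1‖ * Real.exp (-‖z.2‖ ^ 2 / 2)))
      ((volume.restrict (Ioc 0 1)).prod volume) :=
  ((H.integrable_weighted_field hLv).const_mul A).add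
    ((H'.integrable_weighted_field hLv).const_mul A')

theorem integrable_growthBound [IsProbabilityMeasure p] (H : RegularDensityFlow C₁ L Lv p v Φ ρ)
    (H' : RegularDensityFlow C₁ L Lv p v' Φ' ρ') (hLv : 0 ≤ Lv) (hδ : 0 < δ) {c : ℝ → ℝ}
    (hc : Measurable c) :
    Integrable (fun z => growthBound δ L v v' ρ ρ' (c z.1) z)
      ((volume.restrict (Ioc 0 1)).prod volume) := by
  refine (integrable_growthBound_majorant H H' hLv (4 * L * δ⁻¹ * C₁)
    (4 * L * δ⁻¹ * C₁ * (2 + δ⁻¹))).mono'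
    (measurable_growthBound H H' hc).aestronglyMeasurable
    (ae_of_all _ fun z => ?_)
  rw [Real.norm_of_nonneg (growthBound_nonneg H H' hδ _ z)]
  exact growthBound_le (t := c z.1) H H' (hδ := hδ) (z := z)

/-- The divergence `∫ ρ² / (ρ' + δ ρ)` grows between two times at most by the integral of the growth
bound taken with the later time. -/
theorem integral_dampedRatio_sub_le [IsProbabilityMeasure p]
    (H : RegularDensityFlow C₁ L Lv p v Φ ρ) (H' : RegularDensityFlow C₁ L Lv p v' Φ' ρ')
    (hLv : 0 ≤ Lv) (hδ : 0 < δ) {a b : ℝ} (ha : 0 ≤ a) (hab : a ≤ b) (hb : b ≤ 1) :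
    (∫ x, dampedRatio δ (ρ b) (ρ' b) x * ρ b x) - ∫ x, dampedRatio δ (ρ a) (ρ' a) x * ρ a x ≤
      ∫ z, growthBound δ L v v' ρ ρ' b z ∂((volume.restrict (Ioc a b)).prod volume) := by
  have hL := H.score_const_nonneg
  -- Frozen at the later time, `g` gives equality in the variational formula at `b` and an
  -- inequality at `a`, so the difference of the two is bounded above.
  set g := dampedRatio δ (ρ b) (ρ' b) with hg
  have hg0 : ∀ x, 0 ≤ g x := fun x => dampedRatio_nonneg hδ (H.pos b x) (H'.pos b x)
  have hg1 : ∀ x, g x ≤ δ⁻¹ := fun x => dampedRatio_le_inv hδ (H.pos b x) (H'.pos b x)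
  have hg2 : ∀ x, 1 - δ * g x ∈ Icc (0 : ℝ) 1 := fun x =>
    one_sub_mul_dampedRatio_mem hδ (H.pos b x) (H'.pos b x)
  have hgd : Differentiable ℝ g := differentiable_dampedRatio hδ (H.differentiable b)
    (H'.differentiable b) (H.pos b) (H'.pos b)
  have hgf : ∀ x, ‖fderiv ℝ g x‖ ≤ 2 * (L * (1 + ‖x‖)) * g x := fun x =>
    norm_fderiv_dampedRatio_le hδ (H.differentiable b) (H'.differentiable b) (H.pos b) (H'.pos b)
      (by positivity) (H.norm_fderiv_le b x) (H'.norm_fderiv_le b x)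
  have hgf' : ∀ x, ‖fderiv ℝ g x‖ ≤ 2 * L * δ⁻¹ * (1 + ‖x‖) := fun x => by
    refine (hgf x).trans ?_
    calc 2 * (L * (1 + ‖x‖)) * g x ≤ 2 * (L * (1 + ‖x‖)) * δ⁻¹ := by gcongr; exact hg1 x
      _ = _ := by ring
  have hd1 : ∀ x, HasFDerivAt (fun x => 2 * g x - δ * g x ^ 2)
      ((2 * (1 - δ * g x)) • fderiv ℝ g x) x := fun x => by
    have h := ((hgd x).hasFDerivAt.const_mul 2).sub (((hgd x).hasFDerivAt.pow 2).const_mul δ)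
    refine h.congr_fderiv ?_
    ext y
    simp
    ring
  have hd2 : ∀ x, HasFDerivAt (fun x => g x ^ 2) ((2 * g x) • fderiv ℝ g x) x := fun x => by
    have h := (hgd x).hasFDerivAt.pow 2
    refine h.congr_fderiv ?_
    ext y
    simp
  have hB1 : ∀ x, ‖2 * g x - δ * g x ^ 2‖ ≤ 2 * δ⁻¹ := fun x => by
    have : 2 * g x - δ * g x ^ 2 = g x * (1 + (1 - δ * g x)) := by ring
    rw [this, Real.norm_of_nonneg (mul_nonneg (hg0 x) (by linarith [(hg2 x).1]))]
    nlinarith [hg0 x, hg1 x, (hg2 x).2]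
  have hB2 : ∀ x, ‖g x ^ 2‖ ≤ δ⁻¹ ^ 2 := fun x => by
    rw [Real.norm_of_nonneg (sq_nonneg _)]
    exact pow_le_pow_left₀ (hg0 x) (hg1 x) 2
  have hK1 : ∀ x, ‖fderiv ℝ (fun x => 2 * g x - δ * g x ^ 2) x‖ ≤
      4 * L * δ⁻¹ * (1 + ‖x‖) := fun x => by
    rw [(hd1 x).fderiv, norm_smul, Real.norm_of_nonneg (by linarith [(hg2 x).1])]
    nlinarith [hgf' x, (hg2 x).1, (hg2 x).2, norm_nonneg (fderiv ℝ g x)]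
  have hK2 : ∀ x, ‖fderiv ℝ (fun x => g x ^ 2) x‖ ≤
      4 * L * δ⁻¹ ^ 2 * (1 + ‖x‖) := fun x => by
    rw [(hd2 x).fderiv, norm_smul, Real.norm_of_nonneg (by linarith [hg0 x])]
    calc 2 * g x * ‖fderiv ℝ g x‖ ≤ 2 * δ⁻¹ * (2 * L * δ⁻¹ * (1 + ‖x‖)) := by
          gcongr
          · exact hg1 x
          · exact hgf' x
      _ = _ := by ring
  have hdf1 : Differentiable ℝ fun x => 2 * g x - δ * g x ^ 2 := fun x =>
    (hd1 x).differentiableAt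
  have hdf2 : Differentiable ℝ fun x => g x ^ 2 := fun x => (hd2 x).differentiableAt
  have e1 := H.integral_mul_density_sub hLv hdf1 hB1 hK1 ha hab hb
  have e2 := H'.integral_mul_density_sub hLv hdf2 hB2 hK2 ha hab hb
  have i1 : ∀ t, Integrable fun x => (2 * g x - δ * g x ^ 2) * ρ t x := fun t =>
    (H.integrable_density t).bdd_mul hdf1.continuous.aestronglyMeasurable (ae_of_all _ hB1)
  have i2 : ∀ t, Integrable fun x => g x ^ 2 * ρ' t x := fun t =>
    (H'.integrable_density t).bdd_mul hdf2.continuous.aestronglyMeasurable (ae_of_all _ hB2)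
  have hFb : ∫ x, g x * ρ b x =
      (∫ x, (2 * g x - δ * g x ^ 2) * ρ b x) - ∫ x, g x ^ 2 * ρ' b x := by
    rw [← integral_sub (i1 b) (i2 b)]
    exact integral_congr_ae (ae_of_all _ fun x => dampedRatio_mul_eq hδ (H.pos b x) (H'.pos b x))
  have hFa : (∫ x, (2 * g x - δ * g x ^ 2) * ρ a x) - ∫ x, g x ^ 2 * ρ' a x ≤
      ∫ x, dampedRatio δ (ρ a) (ρ' a) x * ρ a x := by
    rw [← integral_sub (i1 a) (i2 a)]
    refine integral_mono ((i1 a).sub (i2 a)) ?_ fun x =>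
      two_mul_sub_sq_le_dampedRatio_mul hδ (H.pos a x) (H'.pos a x) (g x)
    refine (H.integrable_density a).bdd_mul (c := δ⁻¹)
      (differentiable_dampedRatio hδ (H.differentiable a) (H'.differentiable a) (H.pos a)
        (H'.pos a)).continuous.aestronglyMeasurable (ae_of_all _ fun x => ?_)
    rw [Real.norm_of_nonneg (dampedRatio_nonneg hδ (H.pos a x) (H'.pos a x))]
    exact dampedRatio_le_inv hδ (H.pos a x) (H'.pos a x)
  have hle : (volume.restrict (Ioc a b)).prod
      (volume : Measure (EuclideanSpace ℝ (Fin d))) ≤ (volume.restrict (Ioc 0 1)).prod volume :=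
    Measure.prod_mono (Measure.restrict_mono (Ioc_subset_Ioc ha hb) le_rfl) le_rfl
  have j1 := (H.integrable_fderiv_mul_density hLv hK1).mono_measure hle
  have j2 := (H'.integrable_fderiv_mul_density hLv hK2).mono_measure hle
  have j3 := (integrable_growthBound H H' hLv hδ (measurable_const (a := b))).mono_measure hle
  have hmono := integral_mono (j1.sub j2) j3 fun z => ?_
  · simp only [Pi.sub_apply] at hmono
    rw [integral_sub j1 j2, ← e1, ← e2] at hmono
    linarith
  · simp only [Pi.sub_apply, (hd1 z.2).fderiv, (hd2 z.2).fderiv, smul_apply,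
      smul_eq_mul]
    have hP := H.pos z.1 z.2
    set D := fderiv ℝ g z.2 with hD
    -- Splitting `v = (v - v') + v'` separates the velocity error from the freezing error, the
    -- latter being `D v'` times `(1 - δ g) ρ - g ρ'`.
    have hDv : D (v z.2 z.1) = D (v z.2 z.1 - v' z.2 z.1) + D (v' z.2 z.1) := by
      rw [map_sub]; ring
    have hD1 : D (v z.2 z.1 - v' z.2 z.1) ≤
        2 * (L * (1 + ‖z.2‖)) * g z.2 * ‖v z.2 z.1 - v' z.2 z.1‖ :=
      (Real.le_norm_self _).trans ((D.le_opNorm _).trans (by gcongr; exact hgf z.2))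
    have hD2 : |D (v' z.2 z.1)| ≤ 2 * (L * (1 + ‖z.2‖)) * g z.2 * ‖v' z.2 z.1‖ :=
      (D.le_opNorm _).trans (by gcongr; exact hgf z.2)
    have hgz := hg0 z.2
    have t1 : 2 * (1 - δ * g z.2) * D (v z.2 z.1 - v' z.2 z.1) * ρ z.1 z.2 ≤
        4 * L * (1 + ‖z.2‖) * g z.2 * (ρ z.1 z.2 * ‖v z.2 z.1 - v' z.2 z.1‖) := by
      set M := 2 * (L * (1 + ‖z.2‖)) * g z.2 * ‖v z.2 z.1 - v' z.2 z.1‖ with hM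
      have hM0 : 0 ≤ M := by positivity
      have : (1 - δ * g z.2) * D (v z.2 z.1 - v' z.2 z.1) ≤ M :=
        (mul_le_mul_of_nonneg_left hD1 (hg2 z.2).1).trans
          (mul_le_of_le_one_left hM0 (hg2 z.2).2)
      calc _ = 2 * ((1 - δ * g z.2) * D (v z.2 z.1 - v' z.2 z.1)) * ρ z.1 z.2 := by ring
        _ ≤ 2 * M * ρ z.1 z.2 := by gcongr
        _ = _ := by rw [hM]; ring
    have t2 : 2 * D (v' z.2 z.1) * ((1 - δ * g z.2) * ρ z.1 z.2 - g z.2 * ρ' z.1 z.2) ≤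
        4 * L * (1 + ‖z.2‖) * g z.2 * (‖v' z.2 z.1‖ *
          |(1 - δ * g z.2) * ρ z.1 z.2 - g z.2 * ρ' z.1 z.2|) := by
      refine (le_abs_self _).trans ?_
      rw [abs_mul, abs_mul, abs_two]
      calc _ ≤ 2 * (2 * (L * (1 + ‖z.2‖)) * g z.2 * ‖v' z.2 z.1‖) *
            |(1 - δ * g z.2) * ρ z.1 z.2 - g z.2 * ρ' z.1 z.2| := by gcongr
        _ = _ := by ring
    have e3 : growthBound δ L v v' ρ ρ' b z =
        4 * L * (1 + ‖z.2‖) * g z.2 * (ρ z.1 z.2 * ‖v z.2 z.1 - v' z.2 z.1‖) +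
        4 * L * (1 + ‖z.2‖) * g z.2 * (‖v' z.2 z.1‖ *
          |(1 - δ * g z.2) * ρ z.1 z.2 - g z.2 * ρ' z.1 z.2|) := by
      rw [growthBound, ← mul_add]
    rw [e3, hDv]
    linarith

end TwoFlows

/-! ### Refining the time partition, integrating the growth, and removing the damping -/

section TwoFlows

variable {d : ℕ} {C₁ L Lv δ : ℝ} {p : Measure (EuclideanSpace ℝ (Fin d))}
  {v Φ v' Φ' : EuclideanSpace ℝ (Fin d) → ℝ → EuclideanSpace ℝ (Fin d)}
  {ρ ρ' : ℝ → EuclideanSpace ℝ (Fin d) → ℝ}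

theorem measurable_natCeil_mul_div (N : ℕ) :
    Measurable fun t : ℝ => (⌈t * N⌉₊ : ℝ) / N :=
  ((measurable_from_nat (f := fun n : ℕ => (n : ℝ))).comp
    (Nat.measurable_ceil.comp (measurable_id.mul_const _))).div_const _

/-- The one-step estimates telescope. Rounding up, `⌈t N⌉₊ / N` is the right endpoint of the
half-open cell containing `t`, which is where each step is frozen. -/
theorem integral_dampedRatio_le_of_partition [IsProbabilityMeasure p]
    (H : RegularDensityFlow C₁ L Lv p v Φ ρ) (H' : RegularDensityFlow C₁ L Lv p v' Φ' ρ')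
    (hLv : 0 ≤ Lv) (hδ : 0 < δ) {N : ℕ} (hN : 0 < N) {k : ℕ} (hk : k ≤ N) :
    ∫ x, dampedRatio δ (ρ (k / N)) (ρ' (k / N)) x * ρ (k / N) x ≤
      (∫ x, dampedRatio δ (ρ 0) (ρ' 0) x * ρ 0 x) +
      ∫ z, growthBound δ L v v' ρ ρ' (⌈z.1 * N⌉₊ / N) z
        ∂((volume.restrict (Ioc 0 (k / N : ℝ))).prod volume) := by
  have hN' : (0 : ℝ) < N := by exact_mod_cast hN
  induction k with
  | zero => simp
  | succ k ih =>
    have ih := ih (by omega)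
    have hk1 : ((k + 1 : ℕ) : ℝ) / N ≤ 1 := by
      rw [div_le_one hN']; exact_mod_cast hk
    have h0 : (0 : ℝ) ≤ k / N := by positivity
    have hle : (k : ℝ) / N ≤ ((k + 1 : ℕ) : ℝ) / N := by gcongr; simp
    have hstep := integral_dampedRatio_sub_le H H' hLv hδ h0 hle hk1
    have hint := integrable_growthBound H H' hLv hδ (measurable_natCeil_mul_div N)
    have hsplit : (volume.restrict (Ioc 0 (((k + 1 : ℕ) : ℝ) / N))).prod
        (volume : Measure (EuclideanSpace ℝ (Fin d))) =
        (volume.restrict (Ioc 0 (k / N : ℝ))).prod volume +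
        (volume.restrict (Ioc (k / N : ℝ) (((k + 1 : ℕ) : ℝ) / N))).prod volume := by
      rw [← Measure.add_prod, ← Measure.restrict_union (Ioc_disjoint_Ioc_of_le le_rfl)
        measurableSet_Ioc, Ioc_union_Ioc_eq_Ioc h0 hle]
    have hsub : ∀ a b : ℝ, 0 ≤ a → b ≤ 1 →
        Integrable (fun z : ℝ × EuclideanSpace ℝ (Fin d) =>
          growthBound δ L v v' ρ ρ' ((⌈z.1 * N⌉₊ : ℝ) / N) z)
          ((volume.restrict (Ioc a b)).prod volume) := fun a b ha hb =>
      hint.mono_measure (Measure.prod_mono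
        (Measure.restrict_mono (Ioc_subset_Ioc ha hb) le_rfl) le_rfl)
    have hcongr : ∫ z, growthBound δ L v v' ρ ρ' (⌈z.1 * N⌉₊ / N) z
          ∂((volume.restrict (Ioc (k / N : ℝ) (((k + 1 : ℕ) : ℝ) / N))).prod volume) =
        ∫ z, growthBound δ L v v' ρ ρ' (((k + 1 : ℕ) : ℝ) / N) z
          ∂((volume.restrict (Ioc (k / N : ℝ) (((k + 1 : ℕ) : ℝ) / N))).prod volume) := by
      refine integral_congr_ae ?_
      have hmem : ∀ᵐ z : ℝ × EuclideanSpace ℝ (Fin d)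
          ∂((volume.restrict (Ioc (k / N : ℝ) (((k + 1 : ℕ) : ℝ) / N))).prod volume),
          z.1 ∈ Ioc (k / N : ℝ) (((k + 1 : ℕ) : ℝ) / N) :=
        Measure.quasiMeasurePreserving_fst.ae (ae_restrict_mem measurableSet_Ioc)
      filter_upwards [hmem] with z hz
      have : ⌈z.1 * N⌉₊ = k + 1 := by
        rw [Nat.ceil_eq_iff (by omega)]
        rw [mem_Ioc, div_lt_iff₀ hN', le_div_iff₀ hN'] at hz
        simpa using hz
      rw [this]
    rw [hsplit, integral_add_measure (hsub _ _ le_rfl (hle.trans hk1)) (hsub _ _ h0 hk1), hcongr]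
    linarith

/-- The growth of the damped divergence over the unit time interval. -/
theorem integral_dampedRatio_one_le [IsProbabilityMeasure p]
    (H : RegularDensityFlow C₁ L Lv p v Φ ρ) (H' : RegularDensityFlow C₁ L Lv p v' Φ' ρ')
    (hLv : 0 ≤ Lv) (hδ : 0 < δ) :
    ∫ x, dampedRatio δ (ρ 1) (ρ' 1) x * ρ 1 x ≤
      (∫ x, dampedRatio δ (ρ 0) (ρ' 0) x * ρ 0 x) +
      ∫ z, growthBound δ L v v' ρ ρ' z.1 z ∂((volume.restrict (Ioc 0 1)).prod volume) := by
  have hlim : Tendsto (fun N : ℕ => ∫ z, growthBound δ L v v' ρ ρ' (⌈z.1 * N⌉₊ / N) z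
      ∂((volume.restrict (Ioc (0 : ℝ) 1)).prod volume)) atTop
      (𝓝 (∫ z, growthBound δ L v v' ρ ρ' z.1 z ∂((volume.restrict (Ioc 0 1)).prod volume))) := by
    refine tendsto_integral_of_dominated_convergence _
      (fun N => (measurable_growthBound H H' (measurable_natCeil_mul_div N)).aestronglyMeasurable)
      (integrable_growthBound_majorant H H' hLv (4 * L * δ⁻¹ * C₁)
        (4 * L * δ⁻¹ * C₁ * (2 + δ⁻¹))) (fun N => ae_of_all _ fun z => ?_) ?_
    · rw [Real.norm_of_nonneg (growthBound_nonneg H H' hδ _ z)]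
      exact growthBound_le H H' hδ _ z
    · have hmem : ∀ᵐ z : ℝ × EuclideanSpace ℝ (Fin d)
          ∂((volume.restrict (Ioc 0 1)).prod volume), z.1 ∈ Ioc (0 : ℝ) 1 :=
        Measure.quasiMeasurePreserving_fst.ae (ae_restrict_mem measurableSet_Ioc)
      filter_upwards [hmem] with z hz
      -- Only the frozen time varies here, so the continuity of the two densities in time is enough.
      have hc : Continuous fun t => growthBound δ L v v' ρ ρ' t z := by
        have h1 := H.continuous_density z.2
        have h2 := H'.continuous_density z.2
        have h3 : Continuous fun t => dampedRatio δ (ρ t) (ρ' t) z.2 :=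
          h1.div (h2.add (h1.const_mul δ)) fun t => by
            have := H.pos t z.2; have := H'.pos t z.2; positivity
        unfold growthBound
        fun_prop
      exact (hc.tendsto z.1).comp
        ((tendsto_nat_ceil_mul_div_atTop hz.1.le).comp tendsto_natCast_atTop_atTop)
  refine ge_of_tendsto (hlim.const_add _) ?_
  filter_upwards [eventually_gt_atTop 0] with N hN
  have h := integral_dampedRatio_le_of_partition H H' hLv hδ hN le_rfl
  have hN' : (N : ℝ) ≠ 0 := by exact_mod_cast hN.ne'
  simpa only [div_self hN'] using h

/-- Both flows are the identity at time `0`, so the densities agree almost everywhere, and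
everywhere by continuity. -/
theorem density_zero_eq (H : RegularDensityFlow C₁ L Lv p v Φ ρ)
    (H' : RegularDensityFlow C₁ L Lv p v' Φ' ρ') : ρ 0 = ρ' 0 := by
  have h0 : (0 : ℝ) ∈ Icc (0 : ℝ) 1 := by simp
  have h1 : (fun x => Φ x 0) = fun x => Φ' x 0 := by
    funext x
    rw [(H.isFlow x).2 0 h0, (H'.isFlow x).2 0 h0]
    simp
  have h2 := H.map_eq 0
  rw [h1, H'.map_eq 0] at h2
  have hc := (H.differentiable 0).continuous
  have hc' := (H'.differentiable 0).continuous
  have h3 := (withDensity_eq_iff_of_sigmaFinite hc'.measurable.ennreal_ofReal.aemeasurable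
    hc.measurable.ennreal_ofReal.aemeasurable).1 h2
  refine (hc.ae_eq_iff_eq volume hc').1 ?_
  filter_upwards [h3] with x hx
  exact ((ENNReal.ofReal_eq_ofReal_iff (H'.pos 0 x).le (H.pos 0 x).le).1 hx).symm

/-- The total growth is controlled by the flow-matching error. -/
theorem integral_growthBound_le [IsProbabilityMeasure p]
    (H : RegularDensityFlow C₁ L Lv p v Φ ρ) (H' : RegularDensityFlow C₁ L Lv p v' Φ' ρ')
    (hδ : 0 < δ) {ε C₂ : ℝ} (hε : 0 < ε) (hC₂ : 0 < C₂)
    (herr : ∫⁻ t in Ioc (0 : ℝ) 1, ∫⁻ x, ENNReal.ofReal (‖v x t - v' x t‖ ^ 2 * ρ t x)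
      ≤ ENNReal.ofReal (ε ^ 2))
    (hratio : ∀ t ∈ Icc (0 : ℝ) 1,
      ∫⁻ x, ENNReal.ofReal ((1 + ‖x‖) ^ 2 * (ρ t x ^ 3 / ρ' t x ^ 2)) ≤ ENNReal.ofReal C₂) :
    ∫ z, growthBound δ L v v' ρ ρ' z.1 z ∂((volume.restrict (Ioc 0 1)).prod volume) ≤
      4 * L * √C₂ * ε := by
  have hL := H.score_const_nonneg
  have hs : 0 < √C₂ := Real.sqrt_pos.2 hC₂
  have hs2 : √C₂ * √C₂ = C₂ := Real.mul_self_sqrt hC₂.le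
  have m1 := H.measurable_density
  have m2 := H'.measurable_density
  have m3 := H.measurable_field_swap
  have m4 := H'.measurable_field_swap
  have me : Measurable fun z : ℝ × EuclideanSpace ℝ (Fin d) =>
      ENNReal.ofReal (‖v z.2 z.1 - v' z.2 z.1‖ ^ 2 * ρ z.1 z.2) :=
    (((m3.sub m4).norm.pow_const 2).mul m1).ennreal_ofReal
  have mr : Measurable fun z : ℝ × EuclideanSpace ℝ (Fin d) =>
      ENNReal.ofReal ((1 + ‖z.2‖) ^ 2 * (ρ z.1 z.2 ^ 3 / ρ' z.1 z.2 ^ 2)) :=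
    (((measurable_const.add measurable_snd.norm).pow_const 2).mul
      ((m1.pow_const 3).div (m2.pow_const 2))).ennreal_ofReal
  -- Young's inequality in place of Cauchy–Schwarz, with weights `√C₂ / ε` and `ε / √C₂` chosen so
  -- that each term integrates to at most `2 L √C₂ ε`.
  have hpt : ∀ z : ℝ × EuclideanSpace ℝ (Fin d), ENNReal.ofReal (growthBound δ L v v' ρ ρ' z.1 z) ≤
      ENNReal.ofReal (2 * L * √C₂ / ε) *
        ENNReal.ofReal (‖v z.2 z.1 - v' z.2 z.1‖ ^ 2 * ρ z.1 z.2) +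
      ENNReal.ofReal (2 * L * ε / √C₂) *
        ENNReal.ofReal ((1 + ‖z.2‖) ^ 2 * (ρ z.1 z.2 ^ 3 / ρ' z.1 z.2 ^ 2)) := fun z => by
    have hP := H.pos z.1 z.2
    have hQ := H'.pos z.1 z.2
    rw [← ENNReal.ofReal_mul (by positivity), ← ENNReal.ofReal_mul (by positivity),
      ← ENNReal.ofReal_add (by positivity) (by positivity)]
    refine ENNReal.ofReal_le_ofReal ?_
    have hg0 := dampedRatio_nonneg hδ hP hQ
    have hg1 := dampedRatio_le_div hδ hP hQ
    -- With the frozen time equal to the current time, the freezing error vanishes identically.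
    rw [growthBound, one_sub_mul_dampedRatio hδ hP hQ, sub_self, abs_zero, mul_zero, add_zero]
    generalize dampedRatio δ (ρ z.1) (ρ' z.1) z.2 = g at *
    generalize ‖v z.2 z.1 - v' z.2 z.1‖ = w
    have hx : 0 ≤ 1 + ‖z.2‖ := by positivity
    generalize 1 + ‖z.2‖ = y at *
    have h1 : g ^ 2 * ρ z.1 z.2 ≤ ρ z.1 z.2 ^ 3 / ρ' z.1 z.2 ^ 2 := by
      calc g ^ 2 * ρ z.1 z.2 ≤ (ρ z.1 z.2 / ρ' z.1 z.2) ^ 2 * ρ z.1 z.2 := by gcongr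
        _ = _ := by field_simp
    have h2 : 2 * (w * (y * g)) ≤ √C₂ / ε * w ^ 2 + ε / √C₂ * (y * g) ^ 2 := by
      have h3 : 0 ≤ (√C₂ * w - ε * (y * g)) ^ 2 / (ε * √C₂) := by positivity
      have h4 : (√C₂ * w - ε * (y * g)) ^ 2 / (ε * √C₂) =
          √C₂ / ε * w ^ 2 + ε / √C₂ * (y * g) ^ 2 - 2 * (w * (y * g)) := by
        field_simp
        ring
      linarith
    calc 4 * L * y * g * (ρ z.1 z.2 * w) = 2 * L * ρ z.1 z.2 * (2 * (w * (y * g))) := by ring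
      _ ≤ 2 * L * ρ z.1 z.2 * (√C₂ / ε * w ^ 2 + ε / √C₂ * (y * g) ^ 2) := by gcongr
      _ = 2 * L * √C₂ / ε * (w ^ 2 * ρ z.1 z.2) +
          2 * L * ε / √C₂ * (y ^ 2 * (g ^ 2 * ρ z.1 z.2)) := by ring
      _ ≤ _ := by gcongr
  rw [integral_eq_lintegral_of_nonneg_ae
    (ae_of_all _ fun z => growthBound_nonneg H H' hδ _ z)
    (measurable_growthBound H H' (c := fun t => t) measurable_id).aestronglyMeasurable]
  refine ENNReal.toReal_le_of_le_ofReal (by positivity) ?_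
  have hr : ∫⁻ t in Ioc (0 : ℝ) 1, ∫⁻ x,
      ENNReal.ofReal ((1 + ‖x‖) ^ 2 * (ρ t x ^ 3 / ρ' t x ^ 2)) ≤ ENNReal.ofReal C₂ := by
    calc _ ≤ ∫⁻ _ in Ioc (0 : ℝ) 1, ENNReal.ofReal C₂ :=
          setLIntegral_mono measurable_const fun t ht => hratio t (Ioc_subset_Icc_self ht)
      _ = _ := by simp
  calc _ ≤ _ := lintegral_mono hpt
    _ = ENNReal.ofReal (2 * L * √C₂ / ε) * (∫⁻ t in Ioc (0 : ℝ) 1, ∫⁻ x,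
          ENNReal.ofReal (‖v x t - v' x t‖ ^ 2 * ρ t x)) +
        ENNReal.ofReal (2 * L * ε / √C₂) * (∫⁻ t in Ioc (0 : ℝ) 1, ∫⁻ x,
          ENNReal.ofReal ((1 + ‖x‖) ^ 2 * (ρ t x ^ 3 / ρ' t x ^ 2))) := by
        rw [lintegral_add_left (me.const_mul _), lintegral_const_mul _ me,
          lintegral_const_mul _ mr, lintegral_prod _ me.aemeasurable,
          lintegral_prod _ mr.aemeasurable]
    _ ≤ ENNReal.ofReal (2 * L * √C₂ / ε) * ENNReal.ofReal (ε ^ 2) +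
        ENNReal.ofReal (2 * L * ε / √C₂) * ENNReal.ofReal C₂ := by gcongr
    _ = ENNReal.ofReal (4 * L * √C₂ * ε) := by
        rw [← ENNReal.ofReal_mul (by positivity), ← ENNReal.ofReal_mul (by positivity),
          ← ENNReal.ofReal_add (by positivity) (by positivity)]
        congr 1
        field_simp
        nlinarith

/-- The terminal densities satisfy `∫ ρ₁² / ρ'₁ ≤ 1 + 4 L √C₂ ε`. -/
theorem lintegral_sq_div_le [IsProbabilityMeasure p]
    (H : RegularDensityFlow C₁ L Lv p v Φ ρ) (H' : RegularDensityFlow C₁ L Lv p v' Φ' ρ')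
    (hLv : 0 ≤ Lv) {ε C₂ : ℝ} (hε : 0 < ε) (hC₂ : 0 < C₂)
    (herr : ∫⁻ t in Ioc (0 : ℝ) 1, ∫⁻ x, ENNReal.ofReal (‖v x t - v' x t‖ ^ 2 * ρ t x)
      ≤ ENNReal.ofReal (ε ^ 2))
    (hratio : ∀ t ∈ Icc (0 : ℝ) 1,
      ∫⁻ x, ENNReal.ofReal ((1 + ‖x‖) ^ 2 * (ρ t x ^ 3 / ρ' t x ^ 2)) ≤ ENNReal.ofReal C₂) :
    ∫⁻ x, ENNReal.ofReal (ρ 1 x ^ 2 / ρ' 1 x) ≤ ENNReal.ofReal (1 + 4 * L * √C₂ * ε) := by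
  have hcd : ∀ δ : ℝ, 0 < δ → ∀ t, Continuous (dampedRatio δ (ρ t) (ρ' t)) := fun δ hδ t =>
    (differentiable_dampedRatio hδ (H.differentiable t) (H'.differentiable t) (H.pos t)
      (H'.pos t)).continuous
  have hint : ∀ δ : ℝ, 0 < δ → ∀ t, Integrable fun x =>
      dampedRatio δ (ρ t) (ρ' t) x * ρ t x := fun δ hδ t =>
    (H.integrable_density t).bdd_mul (c := δ⁻¹) (hcd δ hδ t).aestronglyMeasurable
      (ae_of_all _ fun x => by
        rw [Real.norm_of_nonneg (dampedRatio_nonneg hδ (H.pos t x) (H'.pos t x))]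
        exact dampedRatio_le_inv hδ (H.pos t x) (H'.pos t x))
  have hδle : ∀ δ : ℝ, 0 < δ → ∫⁻ x, ENNReal.ofReal (dampedRatio δ (ρ 1) (ρ' 1) x * ρ 1 x) ≤
      ENNReal.ofReal (1 + 4 * L * √C₂ * ε) := fun δ hδ => by
    rw [← ofReal_integral_eq_lintegral_ofReal (hint δ hδ 1) (ae_of_all _ fun x =>
      mul_nonneg (dampedRatio_nonneg hδ (H.pos 1 x) (H'.pos 1 x)) (H.pos 1 x).le)]
    refine ENNReal.ofReal_le_ofReal ?_
    have h1 := integral_dampedRatio_one_le H H' hLv hδ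
    have h2 := integral_growthBound_le H H' hδ hε hC₂ herr hratio
    have h3 : ∫ x, dampedRatio δ (ρ 0) (ρ' 0) x * ρ 0 x ≤ 1 := by
      rw [← H.integral_density 0]
      refine integral_mono (hint δ hδ 0) (H.integrable_density 0) fun x => ?_
      have h4 := dampedRatio_le_div hδ (H.pos 0 x) (H'.pos 0 x)
      rw [← density_zero_eq H H', div_self (H.pos 0 x).ne'] at h4
      rw [← density_zero_eq H H']
      exact mul_le_of_le_one_left (H.pos 0 x).le h4
    linarith
  -- The growth bound is free of `δ`, so Fatou along `δ = 1 / (n + 1)` recovers the undamped ratio.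
  have hδn : Tendsto (fun n : ℕ => 1 / ((n : ℝ) + 1)) atTop (𝓝 0) :=
    tendsto_one_div_add_atTop_nhds_zero_nat
  have hpt : ∀ x, Tendsto (fun n : ℕ => ENNReal.ofReal
      (dampedRatio (1 / ((n : ℝ) + 1)) (ρ 1) (ρ' 1) x * ρ 1 x)) atTop
      (𝓝 (ENNReal.ofReal (ρ 1 x ^ 2 / ρ' 1 x))) := fun x => by
    refine ENNReal.tendsto_ofReal ?_
    have h1 : Tendsto (fun n : ℕ => ρ' 1 x + 1 / ((n : ℝ) + 1) * ρ 1 x) atTop (𝓝 (ρ' 1 x)) := by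
      simpa using (hδn.mul_const (ρ 1 x)).const_add (ρ' 1 x)
    have h2 := ((tendsto_const_nhds (x := ρ 1 x)).div h1 (H'.pos 1 x).ne').mul_const (ρ 1 x)
    rwa [div_mul_eq_mul_div, ← sq] at h2
  calc ∫⁻ x, ENNReal.ofReal (ρ 1 x ^ 2 / ρ' 1 x)
      = ∫⁻ x, liminf (fun n : ℕ => ENNReal.ofReal
          (dampedRatio (1 / ((n : ℝ) + 1)) (ρ 1) (ρ' 1) x * ρ 1 x)) atTop :=
        lintegral_congr fun x => (hpt x).liminf_eq.symm
    _ ≤ liminf (fun n : ℕ => ∫⁻ x, ENNReal.ofReal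
          (dampedRatio (1 / ((n : ℝ) + 1)) (ρ 1) (ρ' 1) x * ρ 1 x)) atTop :=
        lintegral_liminf_le fun n => ((hcd _ (by positivity) 1).mul
          (H.differentiable 1).continuous).measurable.ennreal_ofReal
    _ ≤ ENNReal.ofReal (1 + 4 * L * √C₂ * ε) :=
        liminf_le_of_le (by isBoundedDefault) fun b hb => by
          obtain ⟨n, hn⟩ := hb.exists
          exact hn.trans (hδle _ (by positivity))

end TwoFlows

/-! ### The flow-matching guarantee -/

section Main

variable {d : ℕ} {C₁ L Lv : ℝ} {p : Measure (EuclideanSpace ℝ (Fin d))}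
  {v Φ : EuclideanSpace ℝ (Fin d) → ℝ → EuclideanSpace ℝ (Fin d)}
  {ρ : ℝ → EuclideanSpace ℝ (Fin d) → ℝ}

/-- Freezing a flow and its densities outside `[0,1]` gives a regular density flow. -/
theorem RegularDensityFlow.of_Icc (hLv : 0 ≤ Lv) (hvm : Measurable (Function.uncurry v))
    (hΦ : IsFlow v Φ) (hρ : IsDensityPath p Φ ρ)
    (hlip : ∀ t ∈ Icc (0 : ℝ) 1, ∀ x y, ‖v x t - v y t‖ ≤ Lv * ‖x - y‖)
    (hbound : ∀ t ∈ Icc (0 : ℝ) 1, ∀ x, 0 < ρ t x ∧ ρ t x ≤ C₁ * Real.exp (-‖x‖ ^ 2 / 2))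
    (hdiff : ∀ t ∈ Icc (0 : ℝ) 1, Differentiable ℝ (ρ t))
    (hscore : ∀ t ∈ Icc (0 : ℝ) 1, ∀ x,
      ‖gradient (fun y => Real.log (ρ t y)) x‖ ≤ L * (1 + ‖x‖)) :
    RegularDensityFlow C₁ L Lv p v (fun x t => Φ x (projIcc 0 1 zero_le_one t))
      (fun t => ρ (projIcc 0 1 zero_le_one t)) := by
  have hproj : ∀ t ∈ Icc (0 : ℝ) 1, (projIcc (0 : ℝ) 1 zero_le_one t : ℝ) = t := fun t ht => by
    rw [projIcc_of_mem _ ht]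
  have hflow : IsFlow v (fun x t => Φ x (projIcc 0 1 zero_le_one t)) := by
    intro x
    have heq : EqOn (fun τ => v (Φ x τ) τ)
        (fun τ => v (Φ x (projIcc (0 : ℝ) 1 zero_le_one τ)) τ) (Icc 0 1) := fun τ hτ => by
      simp only [hproj τ hτ]
    refine ⟨(hΦ x).1.congr fun τ hτ => heq ?_, fun t ht => ?_⟩
    · rw [uIoc_of_le zero_le_one] at hτ
      exact Ioc_subset_Icc_self hτ
    · dsimp only
      rw [hproj t ht, (hΦ x).2 t ht]
      congr 1
      refine intervalIntegral.integral_congr fun τ hτ => heq ?_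
      rw [uIcc_of_le ht.1] at hτ
      exact ⟨hτ.1, hτ.2.trans ht.2⟩
  have hct : ∀ x, Continuous fun t => Φ x (projIcc (0 : ℝ) 1 zero_le_one t) := fun x =>
    (hΦ.continuousOn x).comp_continuous (continuous_subtype_val.comp continuous_projIcc)
      fun t => Subtype.coe_prop _
  refine ⟨hvm, hflow, hlip, hct, fun t => ?_, fun t => hρ _ (Subtype.coe_prop _),
    fun t x => (hbound _ (Subtype.coe_prop _) x).1, fun t x => (hbound _ (Subtype.coe_prop _) x).2,
    fun t => hdiff _ (Subtype.coe_prop _), fun t x => ?_⟩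
  · have hs := Subtype.coe_prop (projIcc (0 : ℝ) 1 zero_le_one t)
    generalize (projIcc (0 : ℝ) 1 zero_le_one t : ℝ) = s at hs
    refine (LipschitzWith.of_dist_le_mul (K := (Real.exp (Lv * s)).toNNReal)
      fun x y => ?_).continuous
    have h := hflow.norm_sub_le hct hLv hlip x y hs
    rw [hproj s hs] at h
    rw [dist_eq_norm, dist_eq_norm, Real.coe_toNNReal _ (Real.exp_nonneg _), mul_comm]
    exact h
  · have hs := Subtype.coe_prop (projIcc (0 : ℝ) 1 zero_le_one t)
    generalize (projIcc (0 : ℝ) 1 zero_le_one t : ℝ) = s at hs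
    have hpos := (hbound s hs x).1
    have h := hscore s hs x
    -- The score is `∇ρ / ρ`; multiplying by `ρ > 0` turns its bound into one on the derivative of
    -- the density.
    rw [gradient, LinearIsometryEquiv.norm_map, fderiv.log (hdiff s hs x) hpos.ne', norm_smul,
      norm_inv, Real.norm_of_nonneg hpos.le, inv_mul_le_iff₀ hpos] at h
    linarith

/-- The terminal map of a regular density flow is a homeomorphism: it is bi-Lipschitz, and its
closed range has full measure for a measure with positive density. -/
theorem RegularDensityFlow.exists_homeomorph (H : RegularDensityFlow C₁ L Lv p v Φ ρ)
    (hLv : 0 ≤ Lv) :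
    ∃ T : EuclideanSpace ℝ (Fin d) ≃ₜ EuclideanSpace ℝ (Fin d), ∀ x, T x = Φ x 1 := by
  have h1 : (1 : ℝ) ∈ Icc (0 : ℝ) 1 := by simp
  have hlip : LipschitzWith (Real.exp Lv).toNNReal fun x => Φ x 1 :=
    LipschitzWith.of_dist_le_mul fun x y => by
      have h := H.isFlow.norm_sub_le H.continuous_time hLv H.lipschitz x y h1
      rw [dist_eq_norm, dist_eq_norm, Real.coe_toNNReal _ (Real.exp_nonneg _), mul_comm]
      simpa using h
  have hanti : AntilipschitzWith (Real.exp Lv).toNNReal fun x => Φ x 1 :=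
    AntilipschitzWith.of_le_mul_dist fun x y => by
      have h := H.isFlow.norm_sub_le_terminal H.continuous_time hLv H.lipschitz x y
      rwa [dist_eq_norm, dist_eq_norm, Real.coe_toNNReal _ (Real.exp_nonneg _)]
  have hcl : IsClosed (range fun x => Φ x 1) := hanti.isClosed_range hlip.uniformContinuous
  have hnull : volume (range fun x => Φ x 1)ᶜ = 0 := by
    have h2 : p.map (fun x => Φ x 1) (range fun x => Φ x 1)ᶜ = 0 := by
      rw [Measure.map_apply hlip.continuous.measurable hcl.measurableSet.compl]
      simp
    rw [H.map_eq 1, withDensity_apply _ hcl.measurableSet.compl] at h2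
    -- A strictly positive density has a positive integral over any set of positive Lebesgue
    -- measure.
    by_contra h3
    have h4 := (setLIntegral_pos_iff
      (H.differentiable 1).continuous.measurable.ennreal_ofReal
      (s := (range fun x => Φ x 1)ᶜ) (μ := volume)).2
    have h5 : Function.support (fun x => ENNReal.ofReal (ρ 1 x)) = univ := by
      ext x; simp [H.pos 1 x]
    rw [h5, univ_inter, h2] at h4
    exact lt_irrefl _ (h4 (pos_iff_ne_zero.2 h3))
  have hsurj : Function.Surjective fun x => Φ x 1 := by
    rw [← range_eq_univ, ← compl_empty_iff]
    exact hcl.isOpen_compl.measure_eq_zero_iff volume |>.1 hnull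
  refine ⟨(Equiv.ofBijective _ ⟨hanti.injective, hsurj⟩).toHomeomorphOfContinuousClosed
    hlip.continuous (hanti.isClosedEmbedding hlip.uniformContinuous).isClosedMap, fun x => rfl⟩

end Main

theorem mainTheorem2 (d : ℕ) (C₁ C₂ L : ℝ) (hC₁ : 0 < C₁) (hC₂ : 0 < C₂) (hL : 0 < L) :
    ∃ CF : ℝ, 0 < CF ∧
      ∀ (ε Lv : ℝ), 0 < ε → 0 < Lv →
      ∀ (p : Measure (EuclideanSpace ℝ (Fin d))) [IsProbabilityMeasure p]
        (v v' : EuclideanSpace ℝ (Fin d) → ℝ → EuclideanSpace ℝ (Fin d)),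
      Measurable (Function.uncurry v) → Measurable (Function.uncurry v') →
      ∀ (Φ Φ' : EuclideanSpace ℝ (Fin d) → ℝ → EuclideanSpace ℝ (Fin d))
        (ρ ρ' : ℝ → EuclideanSpace ℝ (Fin d) → ℝ),
      IsFlow v Φ → IsFlow v' Φ' →
      IsDensityPath p Φ ρ → IsDensityPath p Φ' ρ' →
      p.map (fun x => Φ x 1) = stdGaussian (EuclideanSpace ℝ (Fin d)) →
      FlowMatchingRegularity ε C₁ C₂ L Lv v v' ρ ρ' →
      ∃ T : EuclideanSpace ℝ (Fin d) ≃ₜ EuclideanSpace ℝ (Fin d), (∀ x, T x = Φ' x 1) ∧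
        chiSqDiv (p.map T) (stdGaussian (EuclideanSpace ℝ (Fin d))) ≤ ENNReal.ofReal (CF * ε) ∧
        chiSqDiv p ((stdGaussian (EuclideanSpace ℝ (Fin d))).map T.symm)
          ≤ ENNReal.ofReal (CF * ε) := by
  set κ : ℝ := (2 * Real.pi) ^ (Module.finrank ℝ (EuclideanSpace ℝ (Fin d)) / 2 : ℝ) with hκ
  have hκ0 : 0 < κ := by positivity
  -- `C₁ κ` bounds `ρ' 1` relative to the Gaussian density, whose normalisation is `κ⁻¹`; `4 L √C₂`
  -- is the growth rate of the reverse divergence.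
  refine ⟨C₁ * κ * (4 * L * √C₂), by positivity, ?_⟩
  intro ε Lv hε hLv p _ v v' hvm hvm' Φ Φ' ρ ρ' hΦ hΦ' hρ hρ' hgauss R
  have H := RegularDensityFlow.of_Icc hLv.le hvm hΦ hρ R.lipschitz R.bound R.differentiable R.score
  have H' := RegularDensityFlow.of_Icc hLv.le hvm' hΦ' hρ' R.lipschitz' R.bound' R.differentiable'
    R.score'
  have hproj : ∀ t ∈ Icc (0 : ℝ) 1, (projIcc (0 : ℝ) 1 zero_le_one t : ℝ) = t := fun t ht => by
    rw [projIcc_of_mem _ ht]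
  have h1 : (1 : ℝ) ∈ Icc (0 : ℝ) 1 := by simp
  have hsq := lintegral_sq_div_le H H' hLv.le hε hC₂ ?_ ?_
  rotate_left
  · refine le_trans ?_ R.error
    refine le_trans (le_of_eq ?_) (lintegral_mono_set Ioc_subset_Icc_self)
    refine setLIntegral_congr_fun measurableSet_Ioc fun t ht => ?_
    simp only [hproj t (Ioc_subset_Icc_self ht)]
  · intro t ht
    simpa only [hproj t ht] using R.ratio t ht
  obtain ⟨T, hT⟩ := H'.exists_homeomorph hLv.le
  simp only [hproj 1 h1] at hT hsq
  have hmap' : p.map T = volume.withDensity fun x => ENNReal.ofReal (ρ' 1 x) := by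
    rw [← hρ' 1 h1]
    congr 1
    funext x
    exact hT x
  have hmap : stdGaussian (EuclideanSpace ℝ (Fin d)) =
      volume.withDensity fun x => ENNReal.ofReal (ρ 1 x) := by
    rw [← hρ 1 h1, hgauss]
  have hc := (R.differentiable 1 h1).continuous
  have hc' := (R.differentiable' 1 h1).continuous
  -- The comparison is needed at every point, so the almost everywhere equality with the Gaussian
  -- density is upgraded by continuity.
  have hdens : ρ 1 = fun x => κ⁻¹ * Real.exp (-‖x‖ ^ 2 / 2) := by
    have hcg : Continuous fun x : EuclideanSpace ℝ (Fin d) =>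
      κ⁻¹ * Real.exp (-‖x‖ ^ 2 / 2) := by fun_prop
    have h2 := hmap
    rw [stdGaussian_eq_withDensity, withDensity_eq_iff_of_sigmaFinite
      hcg.measurable.ennreal_ofReal.aemeasurable hc.measurable.ennreal_ofReal.aemeasurable] at h2
    refine (hc.ae_eq_iff_eq volume hcg).1 ?_
    filter_upwards [h2] with x hx
    exact ((ENNReal.ofReal_eq_ofReal_iff (by positivity) (R.bound 1 h1 x).1.le).1 hx).symm
  have hle : ∀ x, ρ' 1 x ≤ C₁ * κ * ρ 1 x := fun x => by
    rw [hdens]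
    refine (R.bound' 1 h1 x).2.trans_eq ?_
    field_simp
  have hone := H.lintegral_density 1
  have hone' := H'.lintegral_density 1
  rw [hproj 1 h1] at hone hone'
  have hchi : chiSqDiv (p.map T) (stdGaussian (EuclideanSpace ℝ (Fin d))) ≤
      ENNReal.ofReal (C₁ * κ * (4 * L * √C₂) * ε) := by
    rw [hmap', hmap, mul_assoc (C₁ * κ)]
    exact chiSqDiv_withDensity_le hc.measurable hc'.measurable (fun x => (R.bound 1 h1 x).1)
      (fun x => (R.bound' 1 h1 x).1) hone hone' (by positivity) (by positivity) hle hsq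
  refine ⟨T, hT, hchi, ?_⟩
  have hp : IsProbabilityMeasure (p.map T) :=
    Measure.isProbabilityMeasure_map T.continuous.measurable.aemeasurable
  -- Pushing both terminal measures forward by `T⁻¹` returns `p` and the generated distribution
  -- without changing the divergence.
  have h3 := chiSqDiv_map_measurableEquiv T.symm.toMeasurableEquiv (p.map T)
    (stdGaussian (EuclideanSpace ℝ (Fin d)))
  rw [Homeomorph.toMeasurableEquiv_coe, Measure.map_map T.symm.continuous.measurable
    T.continuous.measurable, T.symm_comp_self, Measure.map_id] at h3
  rw [h3]
  exact hchi
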